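/- Let $I=[0,1]$, and let $D^2$ be the closed unit disk in $\mathbb R^2$. All maps are continuous. A metrizable space $X$ is an ANR if, whenever $X$ is embedded as a closed subset of a metrizable space $Y$, it is a retract of a neighborhood of $X$ in $Y$. A metric space $Y$ has the disjoint disks property (DDP) if for all maps $f,g:D^2\to Y$ and every $\varepsilon>0$ there are maps $f',g':D^2\to Y$, $\varepsilon$-close to $f$ and $g$ respectively, with $f'(D^2)\cap g'(D^2)=\emptyset$. A $1$-complex is (the polyhedron of) a finite simplicial complex of dimension at most one. Let $X$ be a metric space. Denote by $\mathcal K$ the class of pairs $(f,\tau)$ of maps $f:K\times I\to X$ and $\tau:K\times I\to I$, where $K$ is a $1$-complex and $\tau(z,0)=0$, $\tau(z,1)=1$ for all $z\in K$. Denote by $\mathcal K_c$ the class of those $(f,\tau)\in\mathcal K$ for which $f(z,t)$ does not depend on $t$ and $\tau(z,t)=t$ for all $(z,t)$. For $(f_i,\tau_i)\in\mathcal K$ with $f_i:K_i\times I\to X$ ($i=1,2$), say that $(f_2,\tau_2)$ is fractured over $(f_1,\tau_1)$ if there are finitely many pairwise disjoint balls $B_1,\dots,B_m$ ($m\ge 0$)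 in $K_2\times I$, that is, images of topological embeddings $b_j:D^2\to K_2\times I$, with interiors $\operatorname{int}B_j=b_j(\{x\in D^2:|x|<1\})$, such that 1. $f_2^{-1}(f_1(K_1\times I))\subseteq\bigcup_{j=1}^m\operatorname{int}B_j$; and 2. $\tau_1\bigl(f_1^{-1}(f_2(B_j))\bigr)\neq I$ for every $j$. The space $X$ has the fuzzy ribbons property (FRP) if for all $(f_1,\tau_1)\in\mathcal K_c$, $(f_2,\tau_2)\in\mathcal K$ with $f_i:K_i\times I\to X$, and every $\varepsilon>0$, there are $(f_1',\tau_1'),(f_2',\tau_2')\in\mathcal K$ with $f_i':K_i\times I\to X$ such that $f_i'$ is $\varepsilon$-close to $f_i$ for $i=1,2$ and $(f_2',\tau_2')$ is fractured over $(f_1',\tau_1')$ (no closeness of $\tau_i'$ to $\tau_i$ is required). **Theorem.** If $X$ is an ANR with the fuzzy ribbons property, then $X\times\mathbb R$ has the disjoint disks property. -/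

import Mathlib

namespace Ribbons

universe u

/-- A metrizable space `X` is an *absolute neighborhood retract* (ANR) if for every closed embedding
`i` of `X` into a metrizable space `Y`, the image of `X` is a retract of some open neighborhood `U`
of it in `Y`. -/
def IsANR (X : Type u) [TopologicalSpace X] : Prop :=
  TopologicalSpace.MetrizableSpace X ∧
    ∀ (Y : Type u) [TopologicalSpace Y] [TopologicalSpace.MetrizableSpace Y] (i : X → Y),
      Topology.IsClosedEmbedding i →
        ∃ U : Set Y, IsOpen U ∧ Set.range i ⊆ U ∧
          ∃ r : C(U, X), ∀ (x : X) (hx : i x ∈ U), r ⟨i x, hx⟩ = x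

/-- The closed unit ball `D^m` of Euclidean `m`-space. -/
abbrev Disk (m : ℕ) : Type :=
  Metric.closedBall (0 : EuclideanSpace ℝ (Fin m)) 1

/-- `f'` is an `ε`-approximation of `f`. -/
def IsApprox {Z X : Type*} [TopologicalSpace Z] [MetricSpace X]
    (ε : ℝ) (f' f : C(Z, X)) : Prop :=
  ∀ z, dist (f' z) (f z) < ε

/-- The `(m,n)`-disjoint disks property: any two maps `f : D^m → X` and `g : D^n → X` can be
approximated, arbitrarily closely, by maps with disjoint images. -/
def DisjointDisksProperty (m n : ℕ) (X : Type*) [MetricSpace X] : Prop :=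
  ∀ (f : C(Disk m, X)) (g : C(Disk n, X)) (ε : ℝ), 0 < ε →
    ∃ (f' : C(Disk m, X)) (g' : C(Disk n, X)),
      IsApprox ε f' f ∧ IsApprox ε g' g ∧ Disjoint (Set.range f') (Set.range g')

/-- The disjoint disks property (DDP) is the `(2,2)`-disjoint disks property. -/
def DDP (X : Type*) [MetricSpace X] : Prop :=
  DisjointDisksProperty 2 2 X

/-- The underlying polyhedron of the finite simplicial complex of dimension at most one whose
vertices are the elements of `V` and whose edges are those of the graph `G`: the union, in the
standard simplex on `V`, of the vertices and of the closed edges `[u, v]` with `u`, `v` adjacent.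
(Points are given by their barycentric coordinates; triangles of `G` are not filled in.) -/
def oneComplexSet {V : Type} [Fintype V] (G : SimpleGraph V) : Set (V → ℝ) :=
  {x | x ∈ stdSimplex ℝ V ∧
    ((∃ v, Function.support x ⊆ {v}) ∨ ∃ u v, G.Adj u v ∧ Function.support x ⊆ {u, v})}

/-- The polyhedron of a finite `1`-complex, as a topological space. -/
abbrev OneComplex {V : Type} [Fintype V] (G : SimpleGraph V) : Type :=
  oneComplexSet G

/-- A topographical map pair `(f, τ)` on `Z`: a spatial map `f : Z → X` and a level map
`τ : Z → I`. -/
structure TopographicalMapPair (Z X : Type*) [TopologicalSpace Z] [TopologicalSpace X] where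
  /-- the spatial map -/
  spatial : C(Z, X)
  /-- the level map -/
  level : C(Z, unitInterval)

namespace TopographicalMapPair

variable {Z X : Type*} [TopologicalSpace Z] [TopologicalSpace X]

/-- The category condition on a pair defined on `Z × I`: `Z × {e} ⊆ τ⁻¹(e)` for `e = 0, 1`. For
`Z` a `1`-complex this is membership in the category `𝒦`. -/
def InCategory (p : TopographicalMapPair (Z × unitInterval) X) : Prop :=
  ∀ z, p.level (z, 0) = 0 ∧ p.level (z, 1) = 1

/-- The condition defining the subcategory with index `c`: the pair is in the category, its spatial
map is a constant homotopy, and it is the natural pair associated with that homotopy, that is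
`τ (z, t) = t`. For `Z` a `1`-complex this is membership in `𝒦_c`. -/
def InConstCategory (p : TopographicalMapPair (Z × unitInterval) X) : Prop :=
  p.InCategory ∧ (∀ z s t, p.spatial (z, s) = p.spatial (z, t)) ∧ ∀ z t, p.level (z, t) = t

end TopographicalMapPair

/-- `(f₂, τ₂)` is *fractured* over `(f₁, τ₁)`: there are pairwise disjoint balls `B_1, …, B_m` in
`K₂ × I` whose interiors cover `f₂⁻¹(im f₁)`, and with `τ₁(f₁⁻¹(f₂(B_j))) ≠ I` for every `j`.
A ball is a `2`-cell, the image of `D²` under a topological embedding `b j`; its interior is the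
interior of the cell, that is the image of the open disk. -/
def IsFracturedOver {Z₁ Z₂ X : Type*} [TopologicalSpace Z₁] [TopologicalSpace Z₂]
    [TopologicalSpace X] (p₂ : TopographicalMapPair (Z₂ × unitInterval) X)
    (p₁ : TopographicalMapPair (Z₁ × unitInterval) X) : Prop :=
  ∃ (m : ℕ) (b : Fin m → C(Disk 2, Z₂ × unitInterval)),
    (∀ j, Topology.IsEmbedding (b j)) ∧
    (∀ j k, j ≠ k → Disjoint (Set.range (b j)) (Set.range (b k))) ∧
    p₂.spatial ⁻¹' Set.range p₁.spatial ⊆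
      ⋃ j, b j '' {x : Disk 2 | (x : EuclideanSpace ℝ (Fin 2)) ∈ Metric.ball 0 1} ∧
    ∀ j, p₁.level '' (p₁.spatial ⁻¹' (p₂.spatial '' Set.range (b j))) ≠ Set.univ

/-- The *fuzzy ribbons property* (FRP): for all `(f₁, τ₁) ∈ 𝒦_c`, `(f₂, τ₂) ∈ 𝒦` and `ε > 0` there
are pairs `(f'₁, τ'₁), (f'₂, τ'₂) ∈ 𝒦` such that each `f'ᵢ` is an `ε`-approximation of `fᵢ` and
`(f'₂, τ'₂)` is fractured over `(f'₁, τ'₁)`. The maps `τ'ᵢ` need not be close to `τᵢ`. -/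
def FuzzyRibbonsProperty (X : Type*) [MetricSpace X] : Prop :=
  ∀ (V₁ V₂ : Type) [Fintype V₁] [Fintype V₂] (G₁ : SimpleGraph V₁) (G₂ : SimpleGraph V₂)
    (p₁ : TopographicalMapPair (OneComplex G₁ × unitInterval) X)
    (p₂ : TopographicalMapPair (OneComplex G₂ × unitInterval) X),
    p₁.InConstCategory → p₂.InCategory → ∀ ε : ℝ, 0 < ε →
      ∃ (q₁ : TopographicalMapPair (OneComplex G₁ × unitInterval) X)
        (q₂ : TopographicalMapPair (OneComplex G₂ × unitInterval) X),
        q₁.InCategory ∧ q₂.InCategory ∧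
        IsApprox ε q₁.spatial p₁.spatial ∧ IsApprox ε q₂.spatial p₂.spatial ∧
        IsFracturedOver q₂ q₁

end Ribbons

open Set Filter Topology Metric

namespace Ribbons

universe u

/-! ### Extension of nearby maps into an absolute neighborhood retract -/

/-! Each disk is replaced by a clique complex of dimension at most two on which the `ℝ`-coordinate
is, up to scale, nearly an affine height, with integral values at the vertices that differ on
adjacent vertices (`exists_complex_model`). The open slab between heights `c` and `c + 1` contains
no vertex, and a triangle has at most two edges crossing it. Hence the slab is a graph times an
interval, and the map to `X` becomes a homotopy of that graph.

Integral levels: such a level set is pushed, inside simplices, into the 1-skeleton. Maps of graphs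
into `X` have disjoint approximations: against a path the fuzzy ribbons property leaves no balls,
since a disk does not embed in an interval, and edges are then treated one at a time
(`exists_disjoint_graph_maps`). The ANR property extends the correction over the whole complex.

Slabs: when one pair is fractured over another, each ball `B_j` misses some value `s_j` of the first
level map. The second level map may be replaced by one equal to `s_j` on the part of `B_j` that
meets the first image, and then the maps (space, level) into `X × ℝ` are disjoint
(`IsFracturedOver.exists_level`). Only one homotopy may move in an application of the property, so
one moves while the other rests, and then the roles are exchanged (`exists_separated_ribbonNhd`).

The new levels are uncontrolled but stay in their slab. The error in height is therefore at most one
unit, which is small after rescaling the line. -/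

/-- The Kuratowski embedding of a metric space with base point `x₀`. -/
noncomputable def kuratowskiMap {X : Type u} [MetricSpace X] (x₀ x : X) :
    BoundedContinuousFunction X ℝ :=
  BoundedContinuousFunction.ofNormedAddCommGroup (fun y => dist x y - dist x₀ y)
    (by fun_prop) (dist x x₀) (fun y => by
      rw [Real.norm_eq_abs]
      exact abs_dist_sub_le x x₀ y)

@[simp] lemma kuratowskiMap_apply {X : Type u} [MetricSpace X] (x₀ x y : X) :
    kuratowskiMap x₀ x y = dist x y - dist x₀ y := rfl

lemma isometry_kuratowskiMap {X : Type u} [MetricSpace X] (x₀ : X) :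
    Isometry (kuratowskiMap x₀) := by
  refine Isometry.of_dist_eq fun x y => le_antisymm ?_ ?_
  · refine (BoundedContinuousFunction.dist_le dist_nonneg).2 fun z => ?_
    rw [kuratowskiMap_apply, kuratowskiMap_apply, Real.dist_eq]
    have := abs_dist_sub_le x y z
    calc _ = |dist x z - dist y z| := by ring_nf
      _ ≤ _ := this
  · have h := BoundedContinuousFunction.dist_coe_le_dist (f := kuratowskiMap x₀ x)
      (g := kuratowskiMap x₀ y) y
    rw [kuratowskiMap_apply, kuratowskiMap_apply, Real.dist_eq, dist_self] at h
    calc dist x y = |dist x y - dist x₀ y - (0 - dist x₀ y)| := by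
          rw [show dist x y - dist x₀ y - (0 - dist x₀ y) = dist x y by ring,
            abs_of_nonneg dist_nonneg]
      _ ≤ _ := h

/-- After adding `dist x₀`, a point of the image becomes a distance function `dist x`, and a convex
combination of such functions still dominates a positive multiple of one of them. Evaluating
`kuratowskiMap x₀ z - y` at `z` gives the bound. -/
lemma exists_mul_dist_le_of_mem_convexHull {X : Type u} [MetricSpace X] (x₀ : X)
    {y : BoundedContinuousFunction X ℝ}
    (hy : y ∈ convexHull ℝ (range (kuratowskiMap x₀))) :
    ∃ x : X, ∃ c > 0, ∀ z, c * dist x z ≤ dist (kuratowskiMap x₀ z) y := by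
  let S : Set (BoundedContinuousFunction X ℝ) :=
    {y | (∀ z, 0 ≤ y z + dist x₀ z) ∧ ∃ x : X, ∃ c > 0, ∀ z, c * dist x z ≤ y z + dist x₀ z}
  have hS : Convex ℝ S := by
    rintro y ⟨hy0, x, c, hc, hy⟩ y' ⟨hy0', x', c', hc', hy'⟩ a b ha hb hab
    have key : ∀ z, (a • y + b • y') z + dist x₀ z
        = a * (y z + dist x₀ z) + b * (y' z + dist x₀ z) := fun z => by
      simp only [BoundedContinuousFunction.coe_add, BoundedContinuousFunction.coe_smul,
        Pi.add_apply, smul_eq_mul]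
      linear_combination -dist x₀ z * hab
    refine ⟨fun z => ?_, ?_⟩
    · rw [key]
      exact add_nonneg (mul_nonneg ha (hy0 z)) (mul_nonneg hb (hy0' z))
    · rcases ha.eq_or_lt with rfl | ha
      · refine ⟨x', c', hc', fun z => ?_⟩
        rw [key, show b = 1 by linarith]
        linarith [hy' z]
      · refine ⟨x, a * c, mul_pos ha hc, fun z => ?_⟩
        rw [key]
        have := mul_le_mul_of_nonneg_left (hy z) ha.le
        have := mul_nonneg hb (hy0' z)
        linarith
  have hsub : range (kuratowskiMap x₀) ⊆ S := by
    rintro _ ⟨x, rfl⟩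
    refine ⟨fun z => ?_, x, 1, one_pos, fun z => ?_⟩ <;> simp
  obtain ⟨-, x, c, hc, h⟩ := convexHull_min hsub hS hy
  refine ⟨x, c, hc, fun z => (h z).trans ?_⟩
  have h' := BoundedContinuousFunction.dist_coe_le_dist (f := kuratowskiMap x₀ z) (g := y) z
  rw [kuratowskiMap_apply, dist_self, Real.dist_eq] at h'
  rw [show y z + dist x₀ z = -(0 - dist x₀ z - y z) by ring]
  exact (neg_le_abs _).trans h'

/-- The image need not be closed in the whole function space, but it is closed in its convex hull:
by the preceding bound, points whose images converge to `y` must converge to `x`. The hull is then a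
legitimate ambient space for the ANR property. -/
lemma isClosedEmbedding_kuratowskiMap {X : Type u} [MetricSpace X] (x₀ : X) :
    IsClosedEmbedding (fun x : X =>
      (⟨kuratowskiMap x₀ x, subset_convexHull ℝ _ (mem_range_self x)⟩ :
        convexHull ℝ (range (kuratowskiMap x₀)))) := by
  have hiso : Isometry (fun x : X =>
      (⟨kuratowskiMap x₀ x, subset_convexHull ℝ _ (mem_range_self x)⟩ :
        convexHull ℝ (range (kuratowskiMap x₀)))) :=
    Isometry.of_dist_eq fun x y => (isometry_kuratowskiMap x₀).dist_eq x y
  refine ⟨hiso.isEmbedding, isClosed_of_closure_subset fun y hy => ?_⟩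
  obtain ⟨x, c, hc, h⟩ := exists_mul_dist_le_of_mem_convexHull x₀ y.2
  refine ⟨x, eq_of_forall_dist_le fun ε hε => ?_⟩
  have hε' : 0 < min (ε / 2) (c * (ε / 2)) := by positivity
  obtain ⟨_, ⟨z, rfl⟩, hz⟩ := Metric.mem_closure_iff.1 hy _ hε'
  rw [dist_comm, Subtype.dist_eq] at hz
  have h1 : dist x z ≤ ε / 2 :=
    le_of_mul_le_mul_left (((h z).trans hz.le).trans (min_le_right _ _)) hc
  have h2 : dist (kuratowskiMap x₀ z) y ≤ ε / 2 := hz.le.trans (min_le_left _ _)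
  calc _ = dist (kuratowskiMap x₀ x) (y : BoundedContinuousFunction X ℝ) := rfl
    _ ≤ dist (kuratowskiMap x₀ x) (kuratowskiMap x₀ z) + dist (kuratowskiMap x₀ z) y :=
      dist_triangle _ _ _
    _ ≤ ε := by rw [(isometry_kuratowskiMap x₀).dist_eq]; linarith

/-- A Dugundji type extension theorem with control: if `g` is defined on a closed subset and is
close to the restriction of `F`, it has a continuous extension close to `F`, with values in any
convex set containing those of `F` and `g`. -/
lemma exists_convex_extension_of_close {Z E : Type*} [MetricSpace Z] [CompactSpace Z]
    [NormedAddCommGroup E] [NormedSpace ℝ E] {Y : Set E} (hY : Convex ℝ Y) {A : Set Z}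
    (hA : IsClosed A) (F : C(Z, E)) (g : C(A, E)) (hF : ∀ z, F z ∈ Y) (hg : ∀ a, g a ∈ Y)
    {δ : ℝ} (hδ : 0 < δ) (h : ∀ a : A, dist (g a) (F a) < δ / 2) :
    ∃ D : C(Z, E), (∀ a : A, D a = g a) ∧ ∀ z, D z ∈ Y ∧ dist (D z) (F z) < δ := by
  rcases A.eq_empty_or_nonempty with rfl | hne
  · exact ⟨F, fun a => a.2.elim, fun z => ⟨hF z, by simpa using hδ⟩⟩
  obtain ⟨ρ, hρ, hFρ⟩ := Metric.uniformContinuous_iff.1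
    (CompactSpace.uniformContinuous_of_continuous F.continuous) (δ / 2) (half_pos hδ)
  -- Off `A`, the extension is selected from the convex sets `t z`. Near `A` they only involve
  -- values of `g` at almost nearest points, which forces continuity at `A`.
  let N : Z → Set E := fun z => convexHull ℝ (g '' {a | dist z a < 2 * infDist z A})
  let t : (Aᶜ : Set Z) → Set E := fun z =>
    (Y ∩ ball (F z) δ) ∩ {y | infDist (z : Z) A < ρ / 4 → y ∈ N z}
  have ht : ∀ z, Convex ℝ (t z) := by
    intro z
    refine (hY.inter (convex_ball _ _)).inter ?_
    by_cases hz : infDist (z : Z) A < ρ / 4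
    · simpa [hz] using convex_convexHull ℝ _
    · simpa [hz] using convex_univ
  have hcont : Continuous fun z : (Aᶜ : Set Z) => infDist (z : Z) A :=
    (continuous_infDist_pt A).comp continuous_subtype_val
  -- A locally constant selection is enough, by partitions of unity: a nearby value of `g` close to
  -- `A`, the value `F z₀` elsewhere. The cases split at `ρ / 2`, above the threshold `ρ / 4`, so
  -- that in the second case the condition on `N` is void in a neighbourhood.
  have hloc : ∀ z₀ : (Aᶜ : Set Z), ∃ c : E, ∀ᶠ z in 𝓝 z₀, c ∈ t z := by
    intro z₀
    have hpos : 0 < infDist (z₀ : Z) A := (hA.notMem_iff_infDist_pos hne).1 z₀.2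
    by_cases hz : infDist (z₀ : Z) A < ρ / 2
    · obtain ⟨a, ha, haz⟩ := (infDist_lt_iff (x := (z₀ : Z)) (r := 2 * infDist (z₀ : Z) A)
        hne).1 (by linarith)
      refine ⟨g ⟨a, ha⟩, ?_⟩
      have e1 : ∀ᶠ z : (Aᶜ : Set Z) in 𝓝 z₀, infDist (z : Z) A < ρ / 2 :=
        hcont.continuousAt.eventually_lt continuousAt_const hz
      have e2 : ∀ᶠ z : (Aᶜ : Set Z) in 𝓝 z₀, dist (z : Z) a < 2 * infDist (z : Z) A :=
        (continuous_subtype_val.dist continuous_const).continuousAt.eventually_lt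
          (continuous_const.mul hcont).continuousAt haz
      filter_upwards [e1, e2] with z h1 h2
      refine ⟨⟨hg _, ?_⟩, fun _ => subset_convexHull ℝ _ ⟨⟨a, ha⟩, h2, rfl⟩⟩
      have h3 : dist (F a) (F z) < δ / 2 := hFρ (by rw [dist_comm]; linarith)
      exact (dist_triangle _ (F a) _).trans_lt (by linarith [h ⟨a, ha⟩])
    · refine ⟨F z₀, ?_⟩
      have e1 : ∀ᶠ z : (Aᶜ : Set Z) in 𝓝 z₀, ρ / 4 < infDist (z : Z) A :=
        continuousAt_const.eventually_lt hcont.continuousAt (by linarith)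
      have e2 : ∀ᶠ z : (Aᶜ : Set Z) in 𝓝 z₀, dist (F z₀) (F z) < δ :=
        (continuous_const.dist (F.continuous.comp continuous_subtype_val)).continuousAt.eventually_lt
          continuousAt_const (by simpa using hδ)
      filter_upwards [e1, e2] with z h1 h2
      exact ⟨⟨hF _, h2⟩, fun h3 => absurd h3 h1.not_gt⟩
  obtain ⟨G, hG⟩ := exists_continuous_forall_mem_convex_of_local_const ht hloc
  classical
  let D : Z → E := fun z => if hz : z ∈ A then g ⟨z, hz⟩ else G ⟨z, hz⟩
  have hDA : ∀ z (hz : z ∈ A), D z = g ⟨z, hz⟩ := fun z hz => by simp [D, hz]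
  have hDG : ∀ z (hz : z ∉ A), D z = G ⟨z, hz⟩ := fun z hz => by simp [D, hz]
  have hD : Continuous D := by
    refine continuous_iff_continuousAt.2 fun z₀ => ?_
    by_cases hz : z₀ ∈ A
    · rw [Metric.continuousAt_iff]
      intro ε hε
      obtain ⟨r, hr, hgr⟩ := Metric.continuousAt_iff.1
        (g.continuous.continuousAt (x := ⟨z₀, hz⟩)) ε hε
      -- The points `a` used at `z` satisfy `dist a z₀ < 3 * dist z z₀`, whence `r / 3`.
      refine ⟨min (r / 3) (ρ / 4), by positivity, fun {z} hzz => ?_⟩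
      have h1 : dist z z₀ < r / 3 := hzz.trans_le (min_le_left _ _)
      have h2 : dist z z₀ < ρ / 4 := hzz.trans_le (min_le_right _ _)
      rw [hDA z₀ hz]
      by_cases hzA : z ∈ A
      · rw [hDA z hzA]
        exact hgr (by rw [Subtype.dist_eq]; change dist z z₀ < r; linarith)
      · rw [hDG z hzA]
        have hi : infDist z A ≤ dist z z₀ := infDist_le_dist_of_mem hz
        have hm := (hG ⟨z, hzA⟩).2 (show infDist z A < ρ / 4 by linarith)
        have hsub : N z ⊆ ball (g ⟨z₀, hz⟩) ε := by
          refine convexHull_min ?_ (convex_ball _ _)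
          rintro _ ⟨a, ha, rfl⟩
          refine hgr ?_
          rw [Subtype.dist_eq]
          have ha' : dist z a < 2 * infDist z A := ha
          have := dist_triangle_left (a : Z) z₀ z
          change dist (a : Z) z₀ < r
          linarith
        exact hsub hm
    · have : ContinuousOn D Aᶜ := by
        rw [continuousOn_iff_continuous_domRestrict]
        convert G.continuous using 1
        ext z
        exact hDG z z.2
      exact this.continuousAt (hA.isOpen_compl.mem_nhds hz)
  refine ⟨⟨D, hD⟩, fun a => hDA a a.2, fun z => ?_⟩
  change D z ∈ Y ∧ dist (D z) (F z) < δ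
  by_cases hz : z ∈ A
  · rw [hDA z hz]
    exact ⟨hg _, (h ⟨z, hz⟩).trans (half_lt_self hδ)⟩
  · rw [hDG z hz]
    exact (hG ⟨z, hz⟩).1

/-- Maps defined on a closed subset of a compact metric space, and close to the restriction of a
map `F` into a fixed compact subset of an ANR, extend to maps close to `F`. -/
theorem IsANR.exists_extension_of_close {X : Type u} [MetricSpace X] (hX : IsANR X) {C : Set X}
    (hC : IsCompact C) {ε : ℝ} (hε : 0 < ε) :
    ∃ δ > 0, ∀ (Z : Type) [MetricSpace Z] [CompactSpace Z] (F : C(Z, X)), (∀ z, F z ∈ C) →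
      ∀ A : Set Z, IsClosed A → ∀ g : C(A, X), (∀ a : A, dist (g a) (F a) < δ) →
        ∃ F' : C(Z, X), (∀ a : A, F' a = g a) ∧ ∀ z, dist (F' z) (F z) < ε := by
  rcases isEmpty_or_nonempty X with hE | ⟨⟨x₀⟩⟩
  · exact ⟨1, one_pos, fun Z _ _ F _ A _ g _ => ⟨F, fun a => hE.elim (g a), fun z => hE.elim (F z)⟩⟩
  obtain ⟨U, hU, hiU, r, hr⟩ := hX.2 (convexHull ℝ (range (kuratowskiMap x₀))) _
    (isClosedEmbedding_kuratowskiMap x₀)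
  -- The retraction moves points of the hull near the image of `C` only slightly, uniformly by
  -- compactness. Thus `δ` depends on `C` and not on the domain of the maps.
  have key : ∃ δ > 0, ∀ x ∈ C, ∀ y : convexHull ℝ (range (kuratowskiMap x₀)),
      dist (y : BoundedContinuousFunction X ℝ) (kuratowskiMap x₀ x) < δ →
        ∃ hy : y ∈ U, dist (r ⟨y, hy⟩) x < ε := by
    refine hC.induction_on (p := fun s => ∃ δ > 0, ∀ x ∈ s,
      ∀ y : convexHull ℝ (range (kuratowskiMap x₀)),
      dist (y : BoundedContinuousFunction X ℝ) (kuratowskiMap x₀ x) < δ →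
        ∃ hy : y ∈ U, dist (r ⟨y, hy⟩) x < ε) ⟨1, one_pos, by simp⟩ ?_ ?_ ?_
    · rintro s t hst ⟨δ, hδ, h⟩
      exact ⟨δ, hδ, fun x hx => h x (hst hx)⟩
    · rintro s t ⟨δ, hδ, h⟩ ⟨δ', hδ', h'⟩
      refine ⟨min δ δ', lt_min hδ hδ', fun x hx y hy => ?_⟩
      rcases hx with hx | hx
      · exact h x hx y (hy.trans_le (min_le_left _ _))
      · exact h' x hx y (hy.trans_le (min_le_right _ _))
    · intro x _
      have hxU := hiU (mem_range_self x)
      obtain ⟨ρ₁, hρ₁, h₁⟩ := Metric.isOpen_iff.1 hU _ hxU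
      obtain ⟨ρ₂, hρ₂, h₂⟩ := Metric.continuousAt_iff.1
        (r.continuous.continuousAt (x := ⟨_, hxU⟩)) (ε / 2) (half_pos hε)
      set ρ := min ρ₁ ρ₂ with hρ
      have hρ0 : 0 < ρ := lt_min hρ₁ hρ₂
      refine ⟨ball x (min (ρ / 2) (ε / 2)), mem_nhdsWithin_of_mem_nhds
        (ball_mem_nhds _ (by positivity)), ρ / 2, half_pos hρ0, fun x' hx' y hy => ?_⟩
      rw [mem_ball] at hx'
      have hd : dist (y : BoundedContinuousFunction X ℝ) (kuratowskiMap x₀ x) < ρ := by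
        have h3 := dist_triangle (y : BoundedContinuousFunction X ℝ) (kuratowskiMap x₀ x')
          (kuratowskiMap x₀ x)
        rw [(isometry_kuratowskiMap x₀).dist_eq x' x] at h3
        linarith [hx'.trans_le (min_le_left _ _)]
      have hyU : y ∈ U := h₁ (hd.trans_le (min_le_left _ _))
      refine ⟨hyU, ?_⟩
      have h4 : dist (r ⟨y, hyU⟩) x < ε / 2 := by
        have := h₂ (x := ⟨y, hyU⟩) (hd.trans_le (min_le_right _ _))
        rwa [hr] at this
      have h5 := dist_triangle_right (r ⟨y, hyU⟩) x' x
      linarith [hx'.trans_le (min_le_right _ _)]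
  obtain ⟨δ, hδ, h⟩ := key
  refine ⟨δ / 2, half_pos hδ, fun Z _ _ F hF A hA g hg => ?_⟩
  have hκ := (isometry_kuratowskiMap x₀).continuous
  obtain ⟨D, hDA, hD⟩ := exists_convex_extension_of_close
    (convex_convexHull ℝ (range (kuratowskiMap x₀))) hA
    ⟨fun z => kuratowskiMap x₀ (F z), hκ.comp F.continuous⟩
    ⟨fun a => kuratowskiMap x₀ (g a), hκ.comp g.continuous⟩
    (fun z => subset_convexHull ℝ _ (mem_range_self _))
    (fun z => subset_convexHull ℝ _ (mem_range_self _)) hδ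
    (fun a => by
      change dist (kuratowskiMap x₀ (g a)) (kuratowskiMap x₀ (F a)) < δ / 2
      rw [(isometry_kuratowskiMap x₀).dist_eq]; exact hg a)
  have hDU : ∀ z, ∃ hy : (⟨D z, (hD z).1⟩ : convexHull ℝ (range (kuratowskiMap x₀))) ∈ U,
      dist (r ⟨_, hy⟩) (F z) < ε := fun z => h _ (hF z) _ (hD z).2
  refine ⟨⟨fun z => r ⟨⟨D z, (hD z).1⟩, (hDU z).1⟩, ?_⟩, fun a => ?_, fun z => (hDU z).2⟩
  · exact r.continuous.comp ((D.continuous.subtype_mk _).subtype_mk _)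
  · rw [← hr (g a) (hiU (mem_range_self _))]
    change r _ = r _
    congr 2
    exact Subtype.ext (hDA a)

/-! ### Disjoint approximations of maps of graphs -/

lemma isClosed_support_subset {V : Type*} (s : Set V) :
    IsClosed {x : V → ℝ | Function.support x ⊆ s} := by
  have : {x : V → ℝ | Function.support x ⊆ s} = ⋂ w ∈ sᶜ, {x | x w = 0} := by
    ext x
    simp only [mem_ofPred_eq, mem_iInter, Function.support_subset_iff', mem_compl_iff]
  rw [this]
  exact isClosed_biInter fun w _ => isClosed_eq (continuous_apply w) continuous_const

lemma isCompact_oneComplexSet {V : Type} [Fintype V] (G : SimpleGraph V) :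
    IsCompact (oneComplexSet G) := by
  have : oneComplexSet G = stdSimplex ℝ V ∩ ((⋃ v, {x | Function.support x ⊆ {v}}) ∪
      ⋃ e ∈ {e : V × V | G.Adj e.1 e.2}, {x | Function.support x ⊆ {e.1, e.2}}) := by
    ext x
    simp only [oneComplexSet, mem_ofPred_eq, mem_inter_iff, mem_union, mem_iUnion, Prod.exists,
      exists_prop]
  rw [this]
  exact (isCompact_stdSimplex ℝ V).inter_right
    ((isClosed_iUnion_of_finite fun v => isClosed_support_subset _).union
      ((toFinite _).isClosed_biUnion fun e _ => isClosed_support_subset _))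

instance {V : Type} [Fintype V] (G : SimpleGraph V) : CompactSpace (OneComplex G) :=
  isCompact_iff_compactSpace.1 (isCompact_oneComplexSet G)

/-- A positive continuous function on a compact set is bounded away from zero. -/
lemma exists_pos_forall_le {Z : Type*} [TopologicalSpace Z] {S : Set Z} (hS : IsCompact S)
    {f : Z → ℝ} (hf : ContinuousOn f S) (h : ∀ z ∈ S, 0 < f z) : ∃ η > 0, ∀ z ∈ S, η ≤ f z :=
  hS.exists_forall_le' hf h

/-- There is no injective map from a disk to an interval. -/
lemma not_injective_disk_to_real (f : C(Disk 2, ℝ)) : ¬ Function.Injective f := by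
  intro hf
  let E := EuclideanSpace ℝ (Fin 2)
  let k : E → ℝ := fun x => f ⟨Homeomorph.unitBall x, ball_subset_closedBall (Homeomorph.unitBall x).2⟩
  have hk : Continuous k := by
    refine f.continuous.comp (Continuous.subtype_mk ?_ _)
    exact continuous_subtype_val.comp Homeomorph.unitBall.continuous
  have hinj : Function.Injective k := fun x y hxy => by
    have h1 := congrArg (fun z : Disk 2 => (z : E)) (hf hxy)
    exact Homeomorph.unitBall.injective (Subtype.ext h1)
  -- Removing a point does not disconnect the plane, so the intermediate value `k y` is attained a
  -- second time.
  have hmid : ∀ x y z : E, k x < k y → k y < k z → False := by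
    intro x y z hxy hyz
    have hc : IsPreconnected ({y}ᶜ : Set E) :=
      (isConnected_compl_singleton_of_one_lt_rank (by simp [E, ← Module.finrank_eq_rank]) y).isPreconnected
    have hx : x ∈ ({y}ᶜ : Set E) := fun h => hxy.ne (congrArg k h)
    have hz : z ∈ ({y}ᶜ : Set E) := fun h => hyz.ne' (congrArg k h)
    obtain ⟨w, hw, hwy⟩ := hc.intermediate_value hx hz hk.continuousOn ⟨hxy.le, hyz.le⟩
    exact hw (hinj hwy)
  let a : Fin 3 → E := ![EuclideanSpace.single 0 0, EuclideanSpace.single 0 1,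
    EuclideanSpace.single 0 2]
  have h01 : k (a 0) ≠ k (a 1) := fun h => by
    simpa [a] using congrArg (fun x : E => x 0) (hinj h)
  have h02 : k (a 0) ≠ k (a 2) := fun h => by
    simpa [a] using congrArg (fun x : E => x 0) (hinj h)
  have h12 : k (a 1) ≠ k (a 2) := fun h => by
    simpa [a] using congrArg (fun x : E => x 0) (hinj h)
  rcases lt_or_gt_of_ne h01 with h1 | h1 <;> rcases lt_or_gt_of_ne h02 with h2 | h2 <;>
    rcases lt_or_gt_of_ne h12 with h3 | h3
  all_goals first
    | exact hmid _ _ _ h1 h3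
    | exact hmid _ _ _ h2 h3
    | exact hmid _ _ _ h1 h2
    | exact hmid _ _ _ h2 h1
    | exact hmid _ _ _ h3 h1
    | exact hmid _ _ _ h3 h2

/-- Over this one-point complex, `K × I` is an interval, so a path is a homotopy to which the fuzzy
ribbons property applies. -/
instance : Subsingleton (OneComplex (⊥ : SimpleGraph Unit)) := by
  refine ⟨fun x y => Subtype.ext (funext fun v => ?_)⟩
  have hx := x.2.1.2
  have hy := y.2.1.2
  simp only [Finset.univ_unique, Finset.sum_singleton] at hx hy
  rw [Subsingleton.elim v default, hx, hy]

/-- In a space with the fuzzy ribbons property, a map of a graph and a path have disjoint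
approximations. -/
lemma FuzzyRibbonsProperty.exists_disjoint_path {X : Type*} [MetricSpace X]
    (hX : FuzzyRibbonsProperty X) {V : Type} [Fintype V] (G : SimpleGraph V)
    (φ : C(OneComplex G, X)) (c : C(unitInterval, X)) {ε : ℝ} (hε : 0 < ε) :
    ∃ (φ' : C(OneComplex G, X)) (c' : C(unitInterval, X)),
      (∀ x, dist (φ' x) (φ x) < ε) ∧ (∀ t, dist (c' t) (c t) < ε) ∧ ∀ x t, φ' x ≠ c' t := by
  obtain ⟨q₁, q₂, -, -, h1, h2, m, b, hb, -, hcov, -⟩ := hX V Unit G ⊥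
    ⟨φ.comp ContinuousMap.fst, ContinuousMap.snd⟩ ⟨c.comp ContinuousMap.snd, ContinuousMap.snd⟩
    ⟨fun z => ⟨rfl, rfl⟩, fun _ _ _ => rfl, fun _ _ => rfl⟩ (fun z => ⟨rfl, rfl⟩) ε hε
  -- A ball would embed a disk in an interval. With no balls, being fractured means having disjoint
  -- images.
  have hm : IsEmpty (Fin m) := by
    refine ⟨fun j => not_injective_disk_to_real
      ⟨fun z => ((b j z).2 : ℝ), by fun_prop⟩ fun z w hzw => (hb j).injective ?_⟩
    exact Prod.ext (Subsingleton.elim _ _) (Subtype.ext hzw)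
  let pt : OneComplex (⊥ : SimpleGraph Unit) :=
    ⟨fun _ => 1, ⟨fun _ => zero_le_one, by simp⟩, Or.inl ⟨(), fun _ _ => rfl⟩⟩
  refine ⟨q₁.spatial.comp ⟨fun x => (x, 0), by fun_prop⟩,
    q₂.spatial.comp ⟨fun t => (pt, t), by fun_prop⟩, fun x => h1 _, fun t => h2 _, fun x t h => ?_⟩
  have : (pt, t) ∈ q₂.spatial ⁻¹' range q₁.spatial := ⟨_, h⟩
  obtain ⟨j, -⟩ := mem_iUnion.1 (hcov this)
  exact hm.elim j

/-- The point of the segment from the vertex `u` to the vertex `v` with parameter `t`. -/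
noncomputable def edgePoint {V : Type*} (u v : V) (t : ℝ) : V → ℝ :=
  fun w => Set.indicator {u} (fun _ => 1 - t) w + Set.indicator {v} (fun _ => t) w

lemma edgePoint_mem {V : Type} [Fintype V] {G : SimpleGraph V} {u v : V} (h : G.Adj u v ∨ u = v)
    {t : ℝ} (ht : t ∈ Icc (0 : ℝ) 1) : edgePoint u v t ∈ oneComplexSet G := by
  classical
  refine ⟨⟨fun w => ?_, ?_⟩, ?_⟩
  · exact add_nonneg (indicator_nonneg (fun _ _ => sub_nonneg.2 ht.2) _)
      (indicator_nonneg (fun _ _ => ht.1) _)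
  · simp [edgePoint, Finset.sum_add_distrib, indicator_apply]
  · have hs : Function.support (edgePoint u v t) ⊆ {u, v} := by
      intro w hw
      by_contra hne
      simp only [mem_insert_iff, mem_singleton_iff, not_or] at hne
      exact hw (by simp [edgePoint, hne.1, hne.2])
    rcases h with h | rfl
    · exact Or.inr ⟨u, v, h, hs⟩
    · exact Or.inl ⟨u, by simpa using hs⟩

lemma edgePoint_eq {V : Type} [Fintype V] {u v : V} {x : V → ℝ} (hx : x ∈ stdSimplex ℝ V)
    (hs : Function.support x ⊆ {u, v}) : edgePoint u v (x v) = x := by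
  classical
  have h0 : ∀ w, w ≠ u → w ≠ v → x w = 0 := fun w h1 h2 => by
    by_contra h
    rcases hs h with h | h
    exacts [h1 h, h2 h]
  have hsum := hx.2
  by_cases huv : u = v
  · subst huv
    have h1 : x u = 1 := by
      rw [← hsum]
      exact (Fintype.sum_eq_single u fun w hw => h0 w hw hw).symm
    ext w
    by_cases hw : w = u
    · simp [edgePoint, hw, h1]
    · simp [edgePoint, hw, h0 w hw hw]
  · have h1 : x u + x v = 1 := by
      rw [← hsum]
      exact (Fintype.sum_eq_add u v huv fun w hw => h0 w hw.1 hw.2).symm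
    ext w
    by_cases hw : w = u
    · subst hw
      simp only [edgePoint, indicator_apply, mem_singleton_iff, if_true, huv, if_false]
      linarith
    · by_cases hw' : w = v
      · simp [edgePoint, hw', Ne.symm huv]
      · simp [edgePoint, hw, hw', h0 w hw hw']

/-- The restriction of `γ` to a closed edge is a path, so it can be pushed off the graph map; the
ANR property extends the perturbed path over the rest of the graph. -/
lemma exists_disjoint_on_edge {X : Type u} [MetricSpace X] (hA : IsANR X)
    (hX : FuzzyRibbonsProperty X) {V₁ V₂ : Type} [Fintype V₁] [Fintype V₂] {G₁ : SimpleGraph V₁}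
    {G₂ : SimpleGraph V₂} (φ : C(OneComplex G₁, X)) (γ : C(OneComplex G₂, X)) {u v : V₂}
    (huv : G₂.Adj u v ∨ u = v) {ε : ℝ} (hε : 0 < ε) :
    ∃ (φ' : C(OneComplex G₁, X)) (γ' : C(OneComplex G₂, X)),
      (∀ x, dist (φ' x) (φ x) < ε) ∧ (∀ y, dist (γ' y) (γ y) < ε) ∧
      ∀ (x : OneComplex G₁) (y : OneComplex G₂), Function.support (y : V₂ → ℝ) ⊆ {u, v} →
        φ' x ≠ γ' y := by
  obtain ⟨δ, hδ, hext⟩ := hA.exists_extension_of_close (isCompact_range γ.continuous) hε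
  let e : C(unitInterval, OneComplex G₂) :=
    ⟨fun t => ⟨edgePoint u v t, edgePoint_mem huv t.2⟩, by
      refine Continuous.subtype_mk (continuous_pi fun w => ?_) _
      classical
      simp only [edgePoint, indicator_apply]
      refine Continuous.add ?_ ?_ <;> split_ifs <;> fun_prop⟩
  obtain ⟨φ', c', hφ, hc, hd⟩ := hX.exists_disjoint_path G₁ φ (γ.comp e) (lt_min hε hδ)
  let A : Set (OneComplex G₂) := {y | Function.support (y : V₂ → ℝ) ⊆ {u, v}}
  have hAc : IsClosed A := (isClosed_support_subset _).preimage continuous_subtype_val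
  let p : C(A, unitInterval) := ⟨fun y => ⟨(y : OneComplex G₂).1 v,
    (y : OneComplex G₂).2.1.1 v, by
      rw [← (y : OneComplex G₂).2.1.2]
      exact Finset.single_le_sum (fun w _ => (y : OneComplex G₂).2.1.1 w) (Finset.mem_univ v)⟩,
    Continuous.subtype_mk ((continuous_apply v).comp
      (continuous_subtype_val.comp continuous_subtype_val)) _⟩
  have hep : ∀ y : A, e (p y) = y := fun y => Subtype.ext (edgePoint_eq y.1.2.1 y.2)
  obtain ⟨γ', hγA, hγ⟩ := hext (OneComplex G₂) γ (fun y => mem_range_self y) A hAc (c'.comp p)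
    fun y => by
      have := (hc (p y)).trans_le (min_le_right _ _)
      rwa [ContinuousMap.comp_apply, hep] at this
  refine ⟨φ', γ', fun x => (hφ x).trans_le (min_le_left _ _), hγ, fun x y hy => ?_⟩
  rw [hγA ⟨y, hy⟩]
  exact hd _ _

/-- In an ANR with the fuzzy ribbons property, two maps of graphs have disjoint approximations. -/
theorem exists_disjoint_graph_maps {X : Type u} [MetricSpace X] (hA : IsANR X)
    (hX : FuzzyRibbonsProperty X) {V₁ V₂ : Type} [Fintype V₁] [Fintype V₂] {G₁ : SimpleGraph V₁}
    {G₂ : SimpleGraph V₂} (φ : C(OneComplex G₁, X)) (γ : C(OneComplex G₂, X))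
    {ε : ℝ} (hε : 0 < ε) :
    ∃ (φ' : C(OneComplex G₁, X)) (γ' : C(OneComplex G₂, X)),
      (∀ x, dist (φ' x) (φ x) < ε) ∧ (∀ y, dist (γ' y) (γ y) < ε) ∧ ∀ x y, φ' x ≠ γ' y := by
  classical
  -- Edges are cleared one by one. Degenerate pairs `(v, v)` are admitted so that isolated vertices
  -- are covered too.
  have key : ∀ s : Finset (V₂ × V₂), (∀ e ∈ s, G₂.Adj e.1 e.2 ∨ e.1 = e.2) →
      ∀ ε > (0 : ℝ), ∃ (φ' : C(OneComplex G₁, X)) (γ' : C(OneComplex G₂, X)),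
      (∀ x, dist (φ' x) (φ x) < ε) ∧ (∀ y, dist (γ' y) (γ y) < ε) ∧
      ∀ (x : OneComplex G₁) (y : OneComplex G₂), ∀ e ∈ s,
        Function.support (y : V₂ → ℝ) ⊆ {e.1, e.2} → φ' x ≠ γ' y := by
    intro s
    induction s using Finset.induction_on with
    | empty =>
      intro _ ε hε
      exact ⟨φ, γ, fun x => by simpa using hε, fun x => by simpa using hε, by simp⟩
    | insert e s _ ih =>
      intro hs ε hε
      obtain ⟨φ₁, γ₁, hφ₁, hγ₁, hd₁⟩ := ih (fun e' he' => hs e' (Finset.mem_insert_of_mem he'))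
        (ε / 2) (half_pos hε)
      let S : Set (OneComplex G₁ × OneComplex G₂) :=
        univ ×ˢ ⋃ e ∈ s, {y : OneComplex G₂ | Function.support (y : V₂ → ℝ) ⊆ {e.1, e.2}}
      have hS : IsCompact S := isCompact_univ.prod (IsClosed.isCompact
        (isClosed_biUnion_finset fun e _ =>
          (isClosed_support_subset _).preimage continuous_subtype_val))
      obtain ⟨η, hη, hle⟩ := exists_pos_forall_le hS (f := fun z => dist (φ₁ z.1) (γ₁ z.2))
        (by fun_prop) (by
          rintro ⟨x, y⟩ ⟨-, hy⟩
          obtain ⟨e', he', hy⟩ := mem_iUnion₂.1 hy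
          exact dist_pos.2 (hd₁ x y e' he' hy))
      -- Two moves of less than `η / 2` cannot close the gap `η` already gained on the earlier
      -- edges.
      obtain ⟨φ₂, γ₂, hφ₂, hγ₂, hd₂⟩ := exists_disjoint_on_edge hA hX φ₁ γ₁
        (hs e (Finset.mem_insert_self _ _)) (ε := min (ε / 2) (η / 2)) (by positivity)
      refine ⟨φ₂, γ₂, fun x => ?_, fun y => ?_, fun x y e' he' hy => ?_⟩
      · linarith [dist_triangle (φ₂ x) (φ₁ x) (φ x), hφ₁ x, (hφ₂ x).trans_le (min_le_left _ _)]
      · linarith [dist_triangle (γ₂ y) (γ₁ y) (γ y), hγ₁ y, (hγ₂ y).trans_le (min_le_left _ _)]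
      · rcases Finset.mem_insert.1 he' with rfl | he'
        · exact hd₂ x y hy
        · intro heq
          have h1 := hle (x, y) ⟨mem_univ _, mem_iUnion₂.2 ⟨e', he', hy⟩⟩
          have h2 := (hφ₂ x).trans_le (min_le_right _ _)
          have h3 := (hγ₂ y).trans_le (min_le_right _ _)
          have h4 := dist_triangle_left (φ₁ x) (γ₁ y) (φ₂ x)
          rw [← heq] at h3
          simp only at h1
          linarith
  obtain ⟨φ', γ', h1, h2, h3⟩ := key (Finset.univ.filter fun e => G₂.Adj e.1 e.2 ∨ e.1 = e.2)
    (fun e he => (Finset.mem_filter.1 he).2) ε hε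
  refine ⟨φ', γ', h1, h2, fun x y => ?_⟩
  rcases y.2.2 with ⟨v, hv⟩ | ⟨u, v, huv, hs⟩
  · exact h3 x y (v, v) (by simp) (by simpa using hv)
  · exact h3 x y (u, v) (by simp [huv]) hs

/-! ### Ribbons: homotopies with levels -/

/-- `u` is a homotopy from `k₀` to `k₁` with levels in `[a, b]`, whose graph is contained in `M`. -/
def IsRibbon {K X : Type*} [TopologicalSpace K] [TopologicalSpace X] (a b : ℝ) (k₀ k₁ : K → X)
    (M : Set (K × ℝ × X × ℝ)) (u : K × ℝ → X × ℝ) : Prop :=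
  ContinuousOn u (univ ×ˢ Icc a b) ∧ (∀ x, u (x, a) = (k₀ x, a)) ∧ (∀ x, u (x, b) = (k₁ x, b)) ∧
    ∀ x, ∀ t ∈ Icc a b, (u (x, t)).2 ∈ Icc a b ∧ (x, t, u (x, t)) ∈ M

/-- The level `e` is only attained at time `e`. -/
def TightAt {K X : Type*} (a b e : ℝ) (u : K × ℝ → X × ℝ) : Prop :=
  ∀ x, ∀ t ∈ Icc a b, (u (x, t)).2 = e → t = e

/-- Two homotopies with levels following each other. -/
noncomputable def ribbonConcat {K X : Type*} (b : ℝ) (u u' : K × ℝ → X × ℝ) : K × ℝ → X × ℝ :=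
  fun z => if z.2 ≤ b then u z else u' z

lemma ribbonConcat_of_le {K X : Type*} {b t : ℝ} {u u' : K × ℝ → X × ℝ} {x : K} (h : t ≤ b) :
    ribbonConcat b u u' (x, t) = u (x, t) := if_pos h

lemma ribbonConcat_of_lt {K X : Type*} {b t : ℝ} {u u' : K × ℝ → X × ℝ} {x : K} (h : b < t) :
    ribbonConcat b u u' (x, t) = u' (x, t) := if_neg h.not_ge

lemma IsRibbon.concat {K X : Type*} [TopologicalSpace K] [TopologicalSpace X] {a b c : ℝ}
    {k₀ k₁ k₂ : K → X} {M : Set (K × ℝ × X × ℝ)} {u u' : K × ℝ → X × ℝ} (hab : a < b) (hbc : b < c)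
    (h : IsRibbon a b k₀ k₁ M u) (h' : IsRibbon b c k₁ k₂ M u') :
    IsRibbon a c k₀ k₂ M (ribbonConcat b u u') := by
  obtain ⟨h1, h2, h3, h4⟩ := h
  obtain ⟨h1', h2', h3', h4'⟩ := h'
  refine ⟨?_, fun x => ?_, fun x => ?_, fun x t ht => ?_⟩
  · rw [← Icc_union_Icc_eq_Icc hab.le hbc.le, prod_union]
    refine ContinuousOn.union_of_isClosed ?_ ?_ (isClosed_univ.prod isClosed_Icc)
      (isClosed_univ.prod isClosed_Icc)
    · exact h1.congr fun z hz => ribbonConcat_of_le hz.2.2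
    · refine h1'.congr ?_
      rintro ⟨x, t⟩ ⟨-, ht⟩
      rcases ht.1.eq_or_lt with rfl | ht'
      · rw [ribbonConcat_of_le le_rfl, h3, h2']
      · exact ribbonConcat_of_lt ht'
  · rw [ribbonConcat_of_le hab.le, h2]
  · rw [ribbonConcat_of_lt hbc, h3']
  · rcases le_or_gt t b with hle | hlt
    · rw [ribbonConcat_of_le hle]
      obtain ⟨h5, h6⟩ := h4 x t ⟨ht.1, hle⟩
      exact ⟨⟨h5.1, h5.2.trans hbc.le⟩, h6⟩
    · rw [ribbonConcat_of_lt hlt]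
      obtain ⟨h5, h6⟩ := h4' x t ⟨hlt.le, ht.2⟩
      exact ⟨⟨hab.le.trans h5.1, h5.2⟩, h6⟩

lemma TightAt.concat_left {K X : Type*} [TopologicalSpace K] [TopologicalSpace X] {a b c : ℝ}
    {k₁ k₂ : K → X} {M : Set (K × ℝ × X × ℝ)} {u u' : K × ℝ → X × ℝ} (hab : a < b)
    (h : TightAt a b a u) (h' : IsRibbon b c k₁ k₂ M u') :
    TightAt a c a (ribbonConcat b u u') := by
  intro x t ht he
  rcases le_or_gt t b with hle | hlt
  · rw [ribbonConcat_of_le hle] at he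
    exact h x t ⟨ht.1, hle⟩ he
  · rw [ribbonConcat_of_lt hlt] at he
    have := (h'.2.2.2 x t ⟨hlt.le, ht.2⟩).1.1
    linarith

lemma TightAt.concat_right {K X : Type*} [TopologicalSpace K] [TopologicalSpace X] {a b c : ℝ}
    {k₀ k₁ : K → X} {M : Set (K × ℝ × X × ℝ)} {u u' : K × ℝ → X × ℝ} (hbc : b < c)
    (h : IsRibbon a b k₀ k₁ M u) (h' : TightAt b c c u') :
    TightAt a c c (ribbonConcat b u u') := by
  intro x t ht he
  rcases le_or_gt t b with hle | hlt
  · rw [ribbonConcat_of_le hle] at he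
    have := (h.2.2.2 x t ⟨ht.1, hle⟩).1.2
    linarith
  · rw [ribbonConcat_of_lt hlt] at he
    exact h' x t ⟨hlt.le, ht.2⟩ he

/-- There are disjoint ribbons from `k₀` to `k₁` and from `l₀` to `l₁` over `[a, b]`; if `TL` or
`TR` holds then they are tight at `a` or at `b`. -/
def Separated {K L X : Type*} [TopologicalSpace K] [TopologicalSpace L] [TopologicalSpace X]
    (a b : ℝ) (k₀ k₁ : K → X) (l₀ l₁ : L → X) (M : Set (K × ℝ × X × ℝ)) (N : Set (L × ℝ × X × ℝ))
    (TL TR : Prop) : Prop :=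
  ∃ (u : K × ℝ → X × ℝ) (v : L × ℝ → X × ℝ), IsRibbon a b k₀ k₁ M u ∧ IsRibbon a b l₀ l₁ N v ∧
    (∀ x y, ∀ s ∈ Icc a b, ∀ t ∈ Icc a b, u (x, s) ≠ v (y, t)) ∧
    (TL → TightAt a b a u ∧ TightAt a b a v) ∧ (TR → TightAt a b b u ∧ TightAt a b b v)

/-! ### Concatenation of disjoint ribbons -/

section Separated

variable {K L X : Type*} [TopologicalSpace K] [TopologicalSpace L] {a b c : ℝ}
  {M : Set (K × ℝ × X × ℝ)} {N : Set (L × ℝ × X × ℝ)}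

lemma Separated.symm [TopologicalSpace X] {k₀ k₁ : K → X} {l₀ l₁ : L → X} {TL TR : Prop}
    (h : Separated a b k₀ k₁ l₀ l₁ M N TL TR) : Separated a b l₀ l₁ k₀ k₁ N M TL TR := by
  obtain ⟨u, v, hu, hv, hd, h1, h2⟩ := h
  exact ⟨v, u, hv, hu, fun x y s hs t ht => (hd y x t ht s hs).symm, fun h => (h1 h).symm,
    fun h => (h2 h).symm⟩

/-- Ribbons over consecutive intervals can only meet at the common level `b`. Tightness of either
one confines it to its end at time `b`; for `u'` this is excluded by `b < s`, and for `v` that end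
also belongs to `v'`, which is disjoint from `u'`. -/
lemma ribbonConcat_ne [TopologicalSpace X] {k₁ k₂ : K → X} {l₀ l₁ l₂ : L → X}
    {u' : K × ℝ → X × ℝ} {v v' : L × ℝ → X × ℝ} (hbc : b < c)
    (hu' : IsRibbon b c k₁ k₂ M u')
    (hv : IsRibbon a b l₀ l₁ N v) (hv' : IsRibbon b c l₁ l₂ N v')
    (hd' : ∀ x y, ∀ s ∈ Icc b c, ∀ t ∈ Icc b c, u' (x, s) ≠ v' (y, t))
    (hT : TightAt b c b u' ∨ TightAt a b b v) {x : K} {y : L} {s t : ℝ} (hs : s ∈ Ioc b c)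
    (ht : t ∈ Icc a b) : u' (x, s) ≠ v (y, t) := by
  intro heq
  have h1 := (hu'.2.2.2 x s ⟨hs.1.le, hs.2⟩).1.1
  have h2 := (hv.2.2.2 y t ht).1.2
  rw [heq] at h1
  have h3 : (v (y, t)).2 = b := le_antisymm h2 h1
  rcases hT with hT | hT
  · exact hs.1.ne' (hT x s ⟨hs.1.le, hs.2⟩ (by rw [heq, h3]))
  · obtain rfl := hT y t ht h3
    rw [hv.2.2.1, ← hv'.2.1] at heq
    exact hd' x y s ⟨hs.1.le, hs.2⟩ t ⟨le_rfl, hbc.le⟩ heq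

/-- Tightness at the junction is needed on one side only. A piece with uncontrolled levels can
therefore be inserted between two pieces whose levels are the time. -/
lemma Separated.concat [TopologicalSpace X] {k₀ k₁ k₂ : K → X} {l₀ l₁ l₂ : L → X}
    {TL T₁ T₂ TR : Prop} (hab : a < b) (hbc : b < c) (h : Separated a b k₀ k₁ l₀ l₁ M N TL T₁)
    (h' : Separated b c k₁ k₂ l₁ l₂ M N T₂ TR) (hT : T₁ ∨ T₂) :
    Separated a c k₀ k₂ l₀ l₂ M N TL TR := by
  obtain ⟨u, v, hu, hv, hd, hL, hR⟩ := h
  obtain ⟨u', v', hu', hv', hd', hL', hR'⟩ := h'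
  have hT1 : TightAt b c b u' ∨ TightAt a b b v := hT.symm.imp (fun h => (hL' h).1) fun h => (hR h).2
  have hT2 : TightAt b c b v' ∨ TightAt a b b u := hT.symm.imp (fun h => (hL' h).2) fun h => (hR h).1
  refine ⟨ribbonConcat b u u', ribbonConcat b v v', hu.concat hab hbc hu', hv.concat hab hbc hv',
    fun x y s hs t ht => ?_,
    fun h => ⟨(hL h).1.concat_left hab hu', (hL h).2.concat_left hab hv'⟩,
    fun h => ⟨(hR' h).1.concat_right hbc hu, (hR' h).2.concat_right hbc hv⟩⟩
  rcases le_or_gt s b with hsb | hsb <;> rcases le_or_gt t b with htb | htb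
  · rw [ribbonConcat_of_le hsb, ribbonConcat_of_le htb]
    exact hd x y s ⟨hs.1, hsb⟩ t ⟨ht.1, htb⟩
  · rw [ribbonConcat_of_le hsb, ribbonConcat_of_lt htb]
    exact (ribbonConcat_ne hbc hv' hu hu' (fun x y s hs t ht => (hd' y x t ht s hs).symm) hT2
      ⟨htb, ht.2⟩ ⟨hs.1, hsb⟩).symm
  · rw [ribbonConcat_of_lt hsb, ribbonConcat_of_le htb]
    exact ribbonConcat_ne hbc hu' hv hv' hd' hT1 ⟨hsb, hs.2⟩ ⟨ht.1, htb⟩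
  · rw [ribbonConcat_of_lt hsb, ribbonConcat_of_lt htb]
    exact hd' x y s ⟨hsb.le, hs.2⟩ t ⟨htb.le, ht.2⟩

/-- Homotopies which are disjoint at each time, with levels given by the time. -/
lemma separated_of_forall_ne [TopologicalSpace X] {f : K × ℝ → X} {g : L × ℝ → X}
    (hf : ContinuousOn f (univ ×ˢ Icc a b)) (hg : ContinuousOn g (univ ×ˢ Icc a b))
    (hfg : ∀ x y, ∀ t ∈ Icc a b, f (x, t) ≠ g (y, t))
    (hM : ∀ x, ∀ t ∈ Icc a b, (x, t, f (x, t), t) ∈ M)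
    (hN : ∀ y, ∀ t ∈ Icc a b, (y, t, g (y, t), t) ∈ N) :
    Separated a b (fun x => f (x, a)) (fun x => f (x, b)) (fun y => g (y, a)) (fun y => g (y, b))
      M N True True := by
  refine ⟨fun z => (f z, z.2), fun z => (g z, z.2),
    ⟨hf.prodMk continuousOn_snd, fun x => rfl, fun x => rfl, fun x t ht => ⟨ht, hM x t ht⟩⟩,
    ⟨hg.prodMk continuousOn_snd, fun x => rfl, fun x => rfl, fun x t ht => ⟨ht, hN x t ht⟩⟩,
    fun x y s hs t ht h => ?_, fun _ => ⟨fun _ _ _ h => h, fun _ _ _ h => h⟩,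
    fun _ => ⟨fun _ _ _ h => h, fun _ _ _ h => h⟩⟩
  obtain ⟨h1, h2⟩ := Prod.ext_iff.1 h
  simp only at h1 h2
  subst h2
  exact hfg x y s hs h1

/-- The affine parameter of `t` in `[a, b]`. -/
noncomputable def affineParam (a b t : ℝ) : unitInterval :=
  projIcc 0 1 zero_le_one ((t - a) / (b - a))

lemma continuous_affineParam (a b : ℝ) : Continuous (affineParam a b) :=
  continuous_projIcc.comp (by fun_prop)

lemma affineParam_left (a b : ℝ) : affineParam a b a = 0 := by
  simp [affineParam]

lemma affineParam_right (hab : a < b) : affineParam a b b = 1 := by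
  simp [affineParam, div_self (sub_pos.2 hab).ne']

/-- Homotopies whose level maps tell them apart. -/
lemma separated_of_level [TopologicalSpace X] (hab : a < b) (f : C(K × unitInterval, X))
    (σ : C(K × unitInterval, unitInterval)) (g : C(L × unitInterval, X))
    (τ : C(L × unitInterval, unitInterval)) (hσ : ∀ x, σ (x, 0) = 0 ∧ σ (x, 1) = 1)
    (hτ : ∀ y, τ (y, 0) = 0 ∧ τ (y, 1) = 1) (hfg : ∀ p q, f p = g q → σ p ≠ τ q)
    (hM : ∀ x, ∀ t ∈ Icc a b, ∀ s r, (x, t, f (x, s), r) ∈ M)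
    (hN : ∀ y, ∀ t ∈ Icc a b, ∀ s r, (y, t, g (y, s), r) ∈ N) :
    Separated a b (fun x => f (x, 0)) (fun x => f (x, 1)) (fun y => g (y, 0)) (fun y => g (y, 1))
      M N False False := by
  have hlev : ∀ r : unitInterval, a + (b - a) * r ∈ Icc a b := fun r =>
    ⟨by nlinarith [r.2.1], by nlinarith [r.2.2]⟩
  have hK : Continuous fun z : K × ℝ => (z.1, affineParam a b z.2) :=
    continuous_fst.prodMk ((continuous_affineParam a b).comp continuous_snd)
  have hL : Continuous fun z : L × ℝ => (z.1, affineParam a b z.2) :=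
    continuous_fst.prodMk ((continuous_affineParam a b).comp continuous_snd)
  refine ⟨fun z => (f (z.1, affineParam a b z.2), a + (b - a) * σ (z.1, affineParam a b z.2)),
    fun z => (g (z.1, affineParam a b z.2), a + (b - a) * τ (z.1, affineParam a b z.2)),
    ⟨?_, fun x => ?_, fun x => ?_, fun x t ht => ⟨hlev _, hM _ _ ht _ _⟩⟩,
    ⟨?_, fun x => ?_, fun x => ?_, fun x t ht => ⟨hlev _, hN _ _ ht _ _⟩⟩,
    fun x y s _ t _ h => ?_, False.elim, False.elim⟩
  · exact ((f.continuous.comp hK).prodMk (continuous_const.add (continuous_const.mul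
      (continuous_subtype_val.comp (σ.continuous.comp hK))))).continuousOn
  · simp [affineParam_left, hσ]
  · simp [affineParam_right hab, hσ]
  · exact ((g.continuous.comp hL).prodMk (continuous_const.add (continuous_const.mul
      (continuous_subtype_val.comp (τ.continuous.comp hL))))).continuousOn
  · simp [affineParam_left, hτ]
  · simp [affineParam_right hab, hτ]
  · obtain ⟨h1, h2⟩ := Prod.ext_iff.1 h
    simp only at h1 h2
    refine hfg _ _ h1 (Subtype.ext ?_)
    have := sub_pos.2 hab
    exact mul_left_cancel₀ this.ne' (add_left_cancel h2)

end Separated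

/-! ### From fractured pairs to disjoint ribbons -/

/-- A function with prescribed values on finitely many disjoint closed sets. -/
lemma exists_continuous_eq_const_on {Z ι : Type*} [TopologicalSpace Z] [NormalSpace Z] [Finite ι]
    {D : ι → Set Z} (hD : ∀ i, IsClosed (D i)) (hd : ∀ i j, i ≠ j → Disjoint (D i) (D j))
    (s : ι → unitInterval) : ∃ τ : C(Z, unitInterval), ∀ i, ∀ z ∈ D i, τ z = s i := by
  classical
  let σ : Z → unitInterval := fun z => if h : ∃ i, z ∈ D i then s h.choose else 0
  have hσ : ∀ i, ∀ z ∈ D i, σ z = s i := by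
    intro i z hz
    have h : ∃ i, z ∈ D i := ⟨i, hz⟩
    have : h.choose = i := by
      by_contra hne
      exact (hd _ _ hne).le_bot ⟨h.choose_spec, hz⟩
    simp only [σ, dif_pos h, this]
  have hc : ContinuousOn σ (⋃ i, D i) :=
    (locallyFinite_of_finite D).continuousOn_iUnion hD fun i =>
      continuousOn_const.congr fun z hz => hσ i z hz
  obtain ⟨τ, hτ⟩ := ContinuousMap.exists_restrict_eq (isClosed_iUnion_of_finite hD)
    ⟨_, continuousOn_iff_continuous_domRestrict.1 hc⟩
  refine ⟨τ, fun i z hz => ?_⟩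
  have := congrArg (fun f : C(_, unitInterval) => f ⟨z, mem_iUnion.2 ⟨i, hz⟩⟩) hτ
  exact this.trans (hσ i z hz)

/-- If a pair is fractured over another one and its ends are off the image of the latter, then its
level map can be replaced by one that tells the two pairs apart. -/
lemma IsFracturedOver.exists_level {Z₁ Z₂ X : Type*} [TopologicalSpace Z₁] [CompactSpace Z₁]
    [TopologicalSpace Z₂] [CompactSpace Z₂] [T2Space Z₂] [TopologicalSpace X] [T2Space X]
    {p₂ : TopographicalMapPair (Z₂ × unitInterval) X}
    {p₁ : TopographicalMapPair (Z₁ × unitInterval) X} (h : IsFracturedOver p₂ p₁)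
    (h0 : ∀ p y, p₁.spatial p ≠ p₂.spatial (y, 0)) (h1 : ∀ p y, p₁.spatial p ≠ p₂.spatial (y, 1)) :
    ∃ τ : C(Z₂ × unitInterval, unitInterval), (∀ y, τ (y, 0) = 0 ∧ τ (y, 1) = 1) ∧
      ∀ p q, p₁.spatial p = p₂.spatial q → p₁.level p ≠ τ q := by
  obtain ⟨m, b, -, hdisj, hcov, hlev⟩ := h
  have hs : ∀ j, ∃ s, s ∉ p₁.level '' (p₁.spatial ⁻¹' (p₂.spatial '' range (b j))) := fun j =>
    (ne_univ_iff_exists_notMem _).1 (hlev j)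
  choose s hs using hs
  let C : Set (Z₂ × unitInterval) := p₂.spatial ⁻¹' range p₁.spatial
  have hC : IsClosed C := (isCompact_range p₁.spatial.continuous).isClosed.preimage
    p₂.spatial.continuous
  let e : Bool → unitInterval := fun i => if i then 1 else 0
  let D : Fin m ⊕ Bool → Set (Z₂ × unitInterval) :=
    Sum.elim (fun j => C ∩ range (b j)) fun i => {z | z.2 = e i}
  have hCe : ∀ i, Disjoint C {z | z.2 = e i} := by
    intro i
    refine disjoint_left.2 ?_
    rintro ⟨y, t⟩ ⟨p, hp⟩ (rfl : t = e i)
    cases i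
    · exact h0 p y hp
    · exact h1 p y hp
  -- The new level map takes on `C ∩ B_j` the value `s j` missed by the first level map over `B_j`,
  -- and `0`, `1` at the ends. These closed sets are disjoint because the ends avoid `C`.
  obtain ⟨τ, hτ⟩ := exists_continuous_eq_const_on (D := D) (s := Sum.elim s e) (by
      rintro (j | i)
      · exact hC.inter (isCompact_range (b j).continuous).isClosed
      · exact isClosed_eq continuous_snd continuous_const) (by
      rintro (j | i) (j' | i') hne
      · exact (hdisj j j' fun h => hne (by rw [h])).mono inter_subset_right inter_subset_right
      · exact (hCe i').mono_left inter_subset_left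
      · exact ((hCe i).mono_left inter_subset_left).symm
      · refine disjoint_left.2 fun z hz hz' => hne ?_
        have hz : z.2 = e i := hz
        have hz' : z.2 = e i' := hz'
        rw [hz] at hz'
        cases i <;> cases i' <;> simp [e] at hz' ⊢)
  refine ⟨τ, fun y => ⟨hτ (Sum.inr false) (y, 0) rfl, hτ (Sum.inr true) (y, 1) rfl⟩,
    fun p q hpq hl => ?_⟩
  have hq : q ∈ C := ⟨p, hpq⟩
  obtain ⟨j, z, -, hz⟩ := mem_iUnion.1 (hcov hq)
  have hτq : τ q = s j := hτ (Sum.inl j) q ⟨hq, z, hz⟩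
  exact hs j ⟨p, ⟨q, ⟨z, hz⟩, hpq.symm⟩, hl.trans hτq⟩

/-- Nearby maps into an ANR are homotopic by a small homotopy. -/
lemma IsANR.exists_homotopy_of_close {X : Type u} [MetricSpace X] (hX : IsANR X) {Z : Type}
    [MetricSpace Z] [CompactSpace Z] (f : C(Z, X)) {ε : ℝ} (hε : 0 < ε) :
    ∃ δ > 0, ∀ f' : C(Z, X), (∀ z, dist (f' z) (f z) < δ) → ∃ H : C(Z × unitInterval, X),
      (∀ z, H (z, 0) = f z) ∧ (∀ z, H (z, 1) = f' z) ∧ ∀ z t, dist (H (z, t)) (f z) < ε := by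
  obtain ⟨δ, hδ, h⟩ := hX.exists_extension_of_close (isCompact_range f.continuous) hε
  refine ⟨δ, hδ, fun f' hf' => ?_⟩
  let A : Set (Z × unitInterval) := {z | z.2 = 0 ∨ z.2 = 1}
  have hA : IsClosed A := (isClosed_eq continuous_snd continuous_const).union
    (isClosed_eq continuous_snd continuous_const)
  -- On `A` the time is `0` or `1`, so the cut at `1 / 2` is never met.
  let g : C(A, X) := ⟨fun z => if ((z : Z × unitInterval).2 : ℝ) ≤ 1 / 2 then f z.1.1 else f' z.1.1,
    Continuous.if_le (by fun_prop) (by fun_prop) (by fun_prop) continuous_const (by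
      rintro ⟨⟨z, t⟩, ht | ht⟩ h <;> exfalso <;> simp only at ht h <;> rw [ht] at h <;>
        norm_num at h)⟩
  obtain ⟨H, hHA, hH⟩ := h (Z × unitInterval) (f.comp ContinuousMap.fst)
    (fun z => mem_range_self _) A hA g (by
      rintro ⟨⟨z, t⟩, ht | ht⟩ <;> simp only at ht <;> subst ht
      · simpa [g] using hδ
      · have : ¬ ((1 : ℝ) ≤ 2⁻¹) := by norm_num
        simpa [g, this] using hf' z)
  refine ⟨H, fun z => ?_, fun z => ?_, fun z t => hH (z, t)⟩
  · rw [hHA ⟨(z, 0), Or.inl rfl⟩]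
    simp [g]
  · rw [hHA ⟨(z, 1), Or.inr rfl⟩]
    have : ¬ ((1 : ℝ) ≤ 2⁻¹) := by norm_num
    simp [g, this]

/-- A constant homotopy `φ` of a graph and a homotopy `g` of another graph, with ends off `φ`, are
approximated by disjoint ribbons. -/
lemma separated_const_of_fuzzyRibbons {X : Type u} [MetricSpace X] (hA : IsANR X)
    (hX : FuzzyRibbonsProperty X) {V₁ V₂ : Type} [Fintype V₁] [Fintype V₂] {G₁ : SimpleGraph V₁}
    {G₂ : SimpleGraph V₂} (φ : C(OneComplex G₁, X)) (g : C(OneComplex G₂ × unitInterval, X))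
    (h : ∀ x y, φ x ≠ g (y, 0) ∧ φ x ≠ g (y, 1)) {ε : ℝ} (hε : 0 < ε) {a b : ℝ} (hab : a < b)
    {M : Set (OneComplex G₁ × ℝ × X × ℝ)} {N : Set (OneComplex G₂ × ℝ × X × ℝ)}
    (hM : ∀ x, ∀ t ∈ Icc a b, ∀ p : X × ℝ, dist p.1 (φ x) < ε → (x, t, p) ∈ M)
    (hN : ∀ y, ∀ t ∈ Icc a b, ∀ p : X × ℝ, (∃ s, dist p.1 (g (y, s)) < ε) → (y, t, p) ∈ N) :
    Separated a b φ φ (fun y => g (y, 0)) (fun y => g (y, 1)) M N True True := by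
  -- `η` is the gap between `φ` and the ends of `g`. Approximations within `η / 2` keep the ends
  -- disjoint, both for `exists_level` and for the connecting homotopies.
  obtain ⟨η, hη, hle⟩ := exists_pos_forall_le
    (isCompact_univ (X := OneComplex G₁ × OneComplex G₂))
    (f := fun z => min (dist (φ z.1) (g (z.2, 0))) (dist (φ z.1) (g (z.2, 1))))
    (by fun_prop) (fun z _ => lt_min (dist_pos.2 (h z.1 z.2).1) (dist_pos.2 (h z.1 z.2).2))
  have hle0 : ∀ x y, η ≤ dist (φ x) (g (y, 0)) := fun x y =>
    (hle (x, y) (mem_univ _)).trans (min_le_left _ _)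
  have hle1 : ∀ x y, η ≤ dist (φ x) (g (y, 1)) := fun x y =>
    (hle (x, y) (mem_univ _)).trans (min_le_right _ _)
  have far : ∀ {p q r : X}, η ≤ dist q r → dist p q < η / 2 → ∀ {p'}, dist p' r < η / 2 → p ≠ p' := by
    rintro p q r h1 h2 p' h3 rfl
    linarith [dist_triangle_left q r p]
  set ρ := min ε (η / 2) with hρ
  have hρ0 : 0 < ρ := lt_min hε (half_pos hη)
  let g0 : C(OneComplex G₂, X) := g.comp ⟨fun y => (y, 0), by fun_prop⟩
  let g1 : C(OneComplex G₂, X) := g.comp ⟨fun y => (y, 1), by fun_prop⟩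
  obtain ⟨δ, hδ, Hδ⟩ := hA.exists_homotopy_of_close φ hρ0
  obtain ⟨δ₀, hδ₀, Hδ₀⟩ := hA.exists_homotopy_of_close g0 hρ0
  obtain ⟨δ₁, hδ₁, Hδ₁⟩ := hA.exists_homotopy_of_close g1 hρ0
  obtain ⟨q₁, q₂, hq₁, hq₂, hc₁, hc₂, hfr⟩ := hX V₁ V₂ G₁ G₂
    ⟨φ.comp ContinuousMap.fst, ContinuousMap.snd⟩ ⟨g, ContinuousMap.snd⟩
    ⟨fun z => ⟨rfl, rfl⟩, fun _ _ _ => rfl, fun _ _ => rfl⟩ (fun z => ⟨rfl, rfl⟩)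
    (min (min ρ δ) (min δ₀ δ₁)) (by positivity)
  have hq1φ : ∀ x t, dist (q₁.spatial (x, t)) (φ x) < min ρ δ := fun x t =>
    (hc₁ (x, t)).trans_le (min_le_left _ _)
  have hq2g : ∀ y t, dist (q₂.spatial (y, t)) (g (y, t)) < ρ := fun y t =>
    (hc₂ (y, t)).trans_le ((min_le_left _ _).trans (min_le_left _ _))
  have hρη : ρ ≤ η / 2 := min_le_right _ _
  have hρε : ρ ≤ ε := min_le_left _ _
  have hq1η : ∀ p, dist (q₁.spatial p) (φ p.1) < η / 2 := fun p =>
    (hq1φ p.1 p.2).trans_le ((min_le_left _ _).trans hρη)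
  have hq2η : ∀ y t, dist (q₂.spatial (y, t)) (g (y, t)) < η / 2 := fun y t =>
    (hq2g y t).trans_le hρη
  obtain ⟨τ, hτ, hτne⟩ := hfr.exists_level
    (fun p y => far (hle0 p.1 y) (hq1η p) (hq2η y 0))
    (fun p y => far (hle1 p.1 y) (hq1η p) (hq2η y 1))
  obtain ⟨A0, hA00, hA01, hA0⟩ := Hδ (q₁.spatial.comp ⟨fun x => (x, 0), by fun_prop⟩)
    fun x => (hq1φ x 0).trans_le (min_le_right _ _)
  obtain ⟨A1, hA10, hA11, hA1⟩ := Hδ (q₁.spatial.comp ⟨fun x => (x, 1), by fun_prop⟩)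
    fun x => (hq1φ x 1).trans_le (min_le_right _ _)
  obtain ⟨B0, hB00, hB01, hB0⟩ := Hδ₀ (q₂.spatial.comp ⟨fun x => (x, 0), by fun_prop⟩)
    fun x => (hc₂ (x, 0)).trans_le ((min_le_right _ _).trans (min_le_left _ _))
  obtain ⟨B1, hB10, hB11, hB1⟩ := Hδ₁ (q₂.spatial.comp ⟨fun x => (x, 1), by fun_prop⟩)
    fun x => (hc₂ (x, 1)).trans_le ((min_le_right _ _).trans (min_le_right _ _))
  obtain ⟨c, hac, hcb⟩ := exists_between hab
  obtain ⟨d, hcd, hdb⟩ := exists_between hcb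
  have had := hac.trans hcd
  -- The ends of the approximations differ from the prescribed ones. Small homotopies on `[a, c]`
  -- and `[d, b]`, with level equal to time, correct this and are tight where they meet the middle
  -- piece.
  have first : Separated a c φ (fun x => q₁.spatial (x, 0)) (fun y => g (y, 0))
      (fun y => q₂.spatial (y, 0)) M N True True := by
    have := separated_of_forall_ne (a := a) (b := c) (M := M) (N := N)
      (f := fun z => A0 (z.1, affineParam a c z.2)) (g := fun z => B0 (z.1, affineParam a c z.2))
      (A0.continuous.comp (continuous_fst.prodMk
        ((continuous_affineParam a c).comp continuous_snd))).continuousOn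
      (B0.continuous.comp (continuous_fst.prodMk
        ((continuous_affineParam a c).comp continuous_snd))).continuousOn
      (fun x y t _ => far (hle0 x y) ((hA0 x _).trans_le hρη) ((hB0 y _).trans_le hρη))
      (fun x t ht => hM x t ⟨ht.1, ht.2.trans hcb.le⟩ _ ((hA0 x _).trans_le hρε))
      (fun y t ht => hN y t ⟨ht.1, ht.2.trans hcb.le⟩ _ ⟨0, (hB0 y _).trans_le hρε⟩)
    simp only [affineParam_left, affineParam_right hac, hA00, hA01, hB00, hB01] at this
    exact this
  have second := separated_of_level hcd q₁.spatial q₁.level q₂.spatial τ hq₁ hτ hτne (M := M) (N := N)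
    (fun x t ht s r => hM x t ⟨hac.le.trans ht.1, ht.2.trans hdb.le⟩ _
      ((hq1φ x s).trans_le ((min_le_left _ _).trans hρε)))
    (fun y t ht s r => hN y t ⟨hac.le.trans ht.1, ht.2.trans hdb.le⟩ _
      ⟨s, (hq2g y s).trans_le hρε⟩)
  have third : Separated d b (fun x => q₁.spatial (x, 1)) φ (fun y => q₂.spatial (y, 1))
      (fun y => g (y, 1)) M N True True := by
    have hσ : Continuous fun t => unitInterval.symm (affineParam d b t) :=
      unitInterval.continuous_symm.comp (continuous_affineParam d b)
    have := separated_of_forall_ne (a := d) (b := b) (M := M) (N := N)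
      (f := fun z => A1 (z.1, unitInterval.symm (affineParam d b z.2)))
      (g := fun z => B1 (z.1, unitInterval.symm (affineParam d b z.2)))
      (A1.continuous.comp (continuous_fst.prodMk (hσ.comp continuous_snd))).continuousOn
      (B1.continuous.comp (continuous_fst.prodMk (hσ.comp continuous_snd))).continuousOn
      (fun x y t _ => far (hle1 x y) ((hA1 x _).trans_le hρη) ((hB1 y _).trans_le hρη))
      (fun x t ht => hM x t ⟨had.le.trans ht.1, ht.2⟩ _ ((hA1 x _).trans_le hρε))
      (fun y t ht => hN y t ⟨had.le.trans ht.1, ht.2⟩ _ ⟨1, (hB1 y _).trans_le hρε⟩)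
    simp only [affineParam_left, affineParam_right hdb, unitInterval.symm_zero,
      unitInterval.symm_one, hA10, hA11, hB10, hB11] at this
    exact this
  exact (first.concat hac hcd second (Or.inl trivial)).concat had hdb third (Or.inr trivial)

/-- The graphs of ribbons which are close to `f` and are given by `f` near the ends. -/
def ribbonNhd {K X : Type*} [TopologicalSpace K] [MetricSpace X] (f : C(K × unitInterval, X))
    (ε η : ℝ) : Set (K × ℝ × X × ℝ) :=
  {z | (∃ s, dist z.2.2.1 (f (z.1, s)) < ε) ∧ ∀ t : unitInterval, (t : ℝ) = z.2.1 →
    ((t : ℝ) < η ∨ 1 - η < t) → z.2.2 = (f (z.1, t), (t : ℝ))}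

/-- In an ANR with the fuzzy ribbons property, homotopies of graphs with disjoint ends are
approximated by disjoint ribbons. -/
theorem exists_separated_ribbonNhd {X : Type u} [MetricSpace X] (hA : IsANR X)
    (hX : FuzzyRibbonsProperty X) {V₁ V₂ : Type} [Fintype V₁] [Fintype V₂] {G₁ : SimpleGraph V₁}
    {G₂ : SimpleGraph V₂} (f : C(OneComplex G₁ × unitInterval, X))
    (g : C(OneComplex G₂ × unitInterval, X))
    (h : ∀ x y, ∀ i j : unitInterval, (i = 0 ∨ i = 1) → (j = 0 ∨ j = 1) → f (x, i) ≠ g (y, j))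
    {ε : ℝ} (hε : 0 < ε) :
    ∃ η > 0, Separated 0 1 (fun x => f (x, 0)) (fun x => f (x, 1)) (fun y => g (y, 0))
      (fun y => g (y, 1)) (ribbonNhd f ε η) (ribbonNhd g ε η) True True := by
  let S : Set ((OneComplex G₁ × unitInterval) × OneComplex G₂ × unitInterval) :=
    {z | (z.1.2 = 0 ∨ z.1.2 = 1) ∧ (z.2.2 = 0 ∨ z.2.2 = 1)}
  have hS : IsClosed S := by
    refine IsClosed.inter (IsClosed.union ?_ ?_) (IsClosed.union ?_ ?_) <;>
      exact isClosed_eq (by fun_prop) (by fun_prop)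
  obtain ⟨d, hd, hle⟩ := exists_pos_forall_le hS.isCompact (f := fun z => dist (f z.1) (g z.2))
    (by fun_prop) (fun z hz => dist_pos.2 (h _ _ _ _ hz.1 hz.2))
  obtain ⟨ρ₁, hρ₁, hf⟩ := Metric.uniformContinuous_iff.1
    (CompactSpace.uniformContinuous_of_continuous f.continuous) (d / 2) (half_pos hd)
  obtain ⟨ρ₂, hρ₂, hg⟩ := Metric.uniformContinuous_iff.1
    (CompactSpace.uniformContinuous_of_continuous g.continuous) (d / 2) (half_pos hd)
  set η := min (min (ρ₁ / 2) (ρ₂ / 2)) (1 / 4) with hη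
  have hη0 : 0 < η := by positivity
  have hη4 : η ≤ 1 / 4 := min_le_right _ _
  have hηρ₁ : η < ρ₁ := ((min_le_left _ _).trans (min_le_left _ _)).trans_lt (half_lt_self hρ₁)
  have hηρ₂ : η < ρ₂ := ((min_le_left _ _).trans (min_le_right _ _)).trans_lt (half_lt_self hρ₂)
  have hend : ∀ s : unitInterval, ((s : ℝ) ≤ η ∨ 1 - η ≤ s) →
      ∃ i : unitInterval, (i = 0 ∨ i = 1) ∧ dist s i ≤ η := by
    rintro s (hs | hs)
    · refine ⟨0, Or.inl rfl, ?_⟩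
      rw [Subtype.dist_eq, Real.dist_eq]
      simpa [abs_of_nonneg s.2.1] using hs
    · refine ⟨1, Or.inr rfl, ?_⟩
      rw [Subtype.dist_eq, Real.dist_eq, abs_sub_comm, Set.Icc.coe_one,
        abs_of_nonneg (sub_nonneg.2 s.2.2)]
      linarith
  -- Opposite ends must be disjoint as well: while one homotopy rests at one end, the other travels
  -- between both of its ends.
  have hne : ∀ x y, ∀ s t : unitInterval, ((s : ℝ) ≤ η ∨ 1 - η ≤ s) → ((t : ℝ) ≤ η ∨ 1 - η ≤ t) →
      f (x, s) ≠ g (y, t) := by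
    intro x y s t hs ht heq
    obtain ⟨i, hi, hsi⟩ := hend s hs
    obtain ⟨j, hj, htj⟩ := hend t ht
    have h1 : dist (f (x, s)) (f (x, i)) < d / 2 :=
      hf (by simpa [Prod.dist_eq] using hsi.trans_lt hηρ₁)
    have h2 : dist (g (y, t)) (g (y, j)) < d / 2 :=
      hg (by simpa [Prod.dist_eq] using htj.trans_lt hηρ₂)
    have h3 : d ≤ dist (f (x, i)) (g (y, j)) := hle ((x, i), (y, j)) ⟨hi, hj⟩
    have h4 := dist_triangle_left (f (x, i)) (g (y, j)) (f (x, s))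
    rw [← heq] at h2
    linarith
  let pr : ℝ → unitInterval := projIcc 0 1 zero_le_one
  have hpr : Continuous pr := continuous_projIcc
  have prof : ∀ t (ht : t ∈ Icc (0 : ℝ) 1), (pr t : ℝ) = t := fun t ht => by
    simp [pr, projIcc_of_mem _ ht]
  -- This compresses time to `[η, 1 - η]`; the two remaining end intervals are followed unchanged.
  let mid : unitInterval → unitInterval := fun s => pr (η + s * (1 - 2 * η))
  have hmid : Continuous mid := hpr.comp (by fun_prop)
  have hmid0 : mid 0 = pr η := by simp [mid]
  have hmid1 : mid 1 = pr (1 - η) := by simp only [mid, Set.Icc.coe_one]; congr 1; ring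
  have hpη : (pr η : ℝ) ≤ η ∨ 1 - η ≤ pr η := Or.inl (prof η ⟨hη0.le, by linarith⟩).le
  have hpη' : (pr (1 - η) : ℝ) ≤ η ∨ 1 - η ≤ pr (1 - η) :=
    Or.inr (prof (1 - η) ⟨by linarith, by linarith⟩).ge
  let fm : C(OneComplex G₁ × unitInterval, X) := f.comp ⟨fun z => (z.1, mid z.2), by fun_prop⟩
  let gm : C(OneComplex G₂ × unitInterval, X) := g.comp ⟨fun z => (z.1, mid z.2), by fun_prop⟩
  have hfm : ∀ x s, fm (x, s) = f (x, mid s) := fun _ _ => rfl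
  have hgm : ∀ x s, gm (x, s) = g (x, mid s) := fun _ _ => rfl
  have inner : ∀ {K : Type} [TopologicalSpace K] (f : C(K × unitInterval, X)) (x : K) (t : ℝ)
      (p : X × ℝ), t ∈ Icc η (1 - η) → (∃ s, dist p.1 (f (x, s)) < ε) →
        (x, t, p) ∈ ribbonNhd f ε η := by
    rintro K _ f x t p ht hp
    refine ⟨hp, fun r hr hr' => ?_⟩
    simp only at hr
    rw [hr] at hr'
    rcases hr' with h | h
    · exact absurd ht.1 h.not_ge
    · exact absurd ht.2 h.not_ge
  have outer : ∀ {K : Type} [TopologicalSpace K] (f : C(K × unitInterval, X)) (x : K),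
      ∀ t ∈ Icc (0 : ℝ) 1, (x, t, f (x, pr t), t) ∈ ribbonNhd f ε η := by
    rintro K _ f x t ht
    refine ⟨⟨pr t, by simpa using hε⟩, ?_⟩
    rintro r rfl -
    simp [pr]
  have hcont : ∀ {K : Type} [TopologicalSpace K] (f : C(K × unitInterval, X)),
      Continuous fun z : K × ℝ => f (z.1, pr z.2) := by
    rintro K _ f
    exact f.continuous.comp (continuous_fst.prodMk (hpr.comp continuous_snd))
  -- Four pieces: both maps follow time on `[0, η]`; `g` moves while `f` rests on `[η, 1 / 2]`; `f`
  -- moves while `g` rests on `[1 / 2, 1 - η]`; both follow time again on `[1 - η, 1]`.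
  have b1 := separated_of_forall_ne (a := 0) (b := η) (M := ribbonNhd f ε η) (N := ribbonNhd g ε η)
    (hcont f).continuousOn (hcont g).continuousOn
    (fun x y t ht => hne x y _ _ (Or.inl ((prof t ⟨ht.1, by linarith [ht.2]⟩).le.trans ht.2))
      (Or.inl ((prof t ⟨ht.1, by linarith [ht.2]⟩).le.trans ht.2)))
    (fun x t ht => outer f x t ⟨ht.1, by linarith [ht.2]⟩)
    (fun x t ht => outer g x t ⟨ht.1, by linarith [ht.2]⟩)
  have b2 := separated_const_of_fuzzyRibbons hA hX (M := ribbonNhd f ε η) (N := ribbonNhd g ε η)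
    (fm.comp ⟨fun x => (x, 0), by fun_prop⟩) gm
    (fun x y => ⟨by
      change fm (x, 0) ≠ _
      rw [hfm, hgm, hmid0]; exact hne _ _ _ _ hpη hpη, by
      change fm (x, 0) ≠ _
      rw [hfm, hgm, hmid0, hmid1]; exact hne _ _ _ _ hpη hpη'⟩) hε
    (show η < 1 / 2 by linarith)
    (fun x t ht p hp => inner f x t p ⟨ht.1, by linarith [ht.2]⟩ ⟨_, hp⟩)
    (fun y t ht p hp => inner g y t p ⟨ht.1, by linarith [ht.2]⟩ ⟨_, hp.choose_spec⟩)
  have b3 := (separated_const_of_fuzzyRibbons hA hX (M := ribbonNhd g ε η) (N := ribbonNhd f ε η)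
    (gm.comp ⟨fun x => (x, 1), by fun_prop⟩) fm
    (fun y x => ⟨by
      change gm (y, 1) ≠ _
      rw [hfm, hgm, hmid0, hmid1]; exact (hne _ _ _ _ hpη hpη').symm, by
      change gm (y, 1) ≠ _
      rw [hfm, hgm, hmid1]; exact (hne _ _ _ _ hpη' hpη').symm⟩) hε
    (show 1 / 2 < 1 - η by linarith)
    (fun x t ht p hp => inner g x t p ⟨by linarith [ht.1], ht.2⟩ ⟨_, hp⟩)
    (fun y t ht p hp => inner f y t p ⟨by linarith [ht.1], ht.2⟩ ⟨_, hp.choose_spec⟩)).symm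
  have b4 := separated_of_forall_ne (a := 1 - η) (b := 1) (M := ribbonNhd f ε η)
    (N := ribbonNhd g ε η) (hcont f).continuousOn (hcont g).continuousOn
    (fun x y t ht => hne x y _ _ (Or.inr (ht.1.trans (prof t ⟨by linarith [ht.1], ht.2⟩).ge))
      (Or.inr (ht.1.trans (prof t ⟨by linarith [ht.1], ht.2⟩).ge)))
    (fun x t ht => outer f x t ⟨by linarith [ht.1], ht.2⟩)
    (fun x t ht => outer g x t ⟨by linarith [ht.1], ht.2⟩)
  have hp0 : pr 0 = 0 := projIcc_left _
  have hp1 : pr 1 = 1 := projIcc_right _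
  simp only [hp0, hp1] at b1 b4
  simp only [hgm, hmid0, hmid1] at b2
  simp only [hfm, hmid0, hmid1] at b3
  have e0 : ⇑(fm.comp ⟨fun x => (x, 0), by fun_prop⟩ : C(OneComplex G₁, X))
      = fun x => f (x, pr η) := by
    funext x; rw [← hmid0]; rfl
  have e1 : ⇑(gm.comp ⟨fun x => (x, 1), by fun_prop⟩ : C(OneComplex G₂, X))
      = fun x => g (x, pr (1 - η)) := by
    funext x; rw [← hmid1]; rfl
  rw [e0] at b2
  rw [e1] at b3
  exact ⟨η, hη0, ((b1.concat hη0 (by linarith) b2 (Or.inl trivial)).concat (by norm_num)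
    (by linarith) b3 (Or.inl trivial)).concat (by linarith) (by linarith) b4 (Or.inl trivial)⟩

/-! ### Clique complexes with a height function, and their slabs -/

/-- The polyhedron of the clique complex of a graph. -/
def cliqueComplex {W : Type} [Fintype W] (Γ : SimpleGraph W) : Set (W → ℝ) :=
  {x | x ∈ stdSimplex ℝ W ∧ ∀ u v, u ≠ v → x u ≠ 0 → x v ≠ 0 → Γ.Adj u v}

/-- Two points of the clique complex belong to a common simplex. -/
def SameSimplex {W : Type} (Γ : SimpleGraph W) (x y : W → ℝ) : Prop :=
  ∀ u v, u ≠ v → (x u ≠ 0 ∨ y u ≠ 0) → (x v ≠ 0 ∨ y v ≠ 0) → Γ.Adj u v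

lemma isCompact_cliqueComplex {W : Type} [Fintype W] (Γ : SimpleGraph W) :
    IsCompact (cliqueComplex Γ) := by
  have : cliqueComplex Γ = stdSimplex ℝ W ∩ ⋂ e ∈ {e : W × W | e.1 ≠ e.2 ∧ ¬ Γ.Adj e.1 e.2},
      {x | x e.1 * x e.2 = 0} := by
    ext x
    simp only [cliqueComplex, mem_ofPred_eq, mem_inter_iff, mem_iInter, Prod.forall, mul_eq_zero]
    refine and_congr_right fun _ => forall₂_congr fun u v => ?_
    tauto
  rw [this]
  exact (isCompact_stdSimplex ℝ W).inter_right (isClosed_biInter fun e _ =>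
    isClosed_eq (by fun_prop) continuous_const)

instance {W : Type} [Fintype W] (Γ : SimpleGraph W) : CompactSpace (cliqueComplex Γ) :=
  isCompact_iff_compactSpace.1 (isCompact_cliqueComplex Γ)

lemma mem_oneComplexSet_of_card_le {V : Type} [Fintype V] {G : SimpleGraph V} {x : V → ℝ}
    (hx : x ∈ stdSimplex ℝ V) (hG : ∀ e e', e ≠ e' → x e ≠ 0 → x e' ≠ 0 → G.Adj e e')
    {T : Finset V} (hT : ∀ e, e ∈ T ↔ x e ≠ 0) (hc : T.card ≤ 2) : x ∈ oneComplexSet G := by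
  classical
  refine ⟨hx, ?_⟩
  have hsupp : Function.support x ⊆ T := fun e he => (hT e).2 he
  rcases (show T.card = 0 ∨ T.card = 1 ∨ T.card = 2 by omega) with h | h | h
  · exfalso
    rw [Finset.card_eq_zero] at h
    have h0 : ∀ e, x e = 0 := fun e => by
      by_contra hne
      have := (hT e).2 hne
      simp [h] at this
    have := hx.2
    simp [h0] at this
  · obtain ⟨e, rfl⟩ := Finset.card_eq_one.1 h
    exact Or.inl ⟨e, by simpa using hsupp⟩
  · obtain ⟨e, e', hne, rfl⟩ := Finset.card_eq_two.1 h
    exact Or.inr ⟨e, e', hG e e' hne ((hT e).1 (by simp)) ((hT e').1 (by simp)), by simpa using hsupp⟩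

/-! ### Balance of a point about its height -/

section Height

variable {W : Type} {h : W → ℤ} {c : ℤ} {x : W → ℝ}

/-- The part of `x` carried by the vertices of height at most `c`. -/
def lowerPart (h : W → ℤ) (c : ℤ) (x : W → ℝ) (w : W) : ℝ := if h w ≤ c then x w else 0

/-- The part of `x` carried by the vertices of height more than `c`. -/
def upperPart (h : W → ℤ) (c : ℤ) (x : W → ℝ) (w : W) : ℝ := if h w ≤ c then 0 else x w

lemma lowerPart_add_upperPart (w : W) : lowerPart h c x w + upperPart h c x w = x w := by
  unfold lowerPart upperPart
  split_ifs <;> simp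

lemma continuous_lowerPart (w : W) : Continuous fun x => lowerPart h c x w := by
  unfold lowerPart
  split_ifs <;> fun_prop

variable [Fintype W]

/-- The affine function on the simplex with given values at the vertices. -/
def height (h : W → ℤ) (x : W → ℝ) : ℝ := ∑ w, x w * h w

lemma continuous_height (h : W → ℤ) : Continuous (height h) := by
  unfold height
  fun_prop

/-- The moment of the lower part of `x`. -/
def lowerMoment (h : W → ℤ) (c : ℤ) (x : W → ℝ) : ℝ :=
  ∑ w, lowerPart h c x w * (height h x - h w)

lemma continuous_lowerMoment : Continuous (lowerMoment h c) := by
  unfold lowerMoment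
  exact continuous_finsetSum _ fun w _ => (continuous_lowerPart w).mul
    ((continuous_height h).sub continuous_const)

lemma lowerPart_nonneg (hx : x ∈ stdSimplex ℝ W) (w : W) : 0 ≤ lowerPart h c x w := by
  unfold lowerPart
  split_ifs
  exacts [hx.1 w, le_rfl]

lemma sum_mul_height_sub (hx : x ∈ stdSimplex ℝ W) : ∑ w, x w * (height h x - h w) = 0 := by
  simp only [mul_sub, Finset.sum_sub_distrib, ← Finset.sum_mul, hx.2, one_mul]
  exact sub_self _

/-- The height is the centre of mass of the vertex heights, so the moments of the two parts about it
balance. -/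
lemma lowerMoment_eq (hx : x ∈ stdSimplex ℝ W) :
    ∑ w, upperPart h c x w * (h w - height h x) = lowerMoment h c x := by
  have h1 : ∑ w, x w * (height h x - h w) = ∑ w, lowerPart h c x w * (height h x - h w)
      + ∑ w, upperPart h c x w * (height h x - h w) := by
    rw [← Finset.sum_add_distrib]
    exact Finset.sum_congr rfl fun w _ => by rw [← add_mul, lowerPart_add_upperPart]
  rw [sum_mul_height_sub hx] at h1
  unfold lowerMoment
  have h2 : ∑ w, upperPart h c x w * (h w - height h x)
      = - ∑ w, upperPart h c x w * (height h x - h w) := by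
    rw [← Finset.sum_neg_distrib]
    exact Finset.sum_congr rfl fun w _ => by ring
  linarith

lemma exists_low (hx : x ∈ stdSimplex ℝ W) (hc : height h x < c + 1) : ∃ w, h w ≤ c ∧ 0 < x w := by
  by_contra! hno
  have : ∑ w, x w * (height h x - h w) < 0 := by
    obtain ⟨w, hw⟩ : ∃ w, 0 < x w := by
      by_contra! hle
      have := hx.2 ▸ Finset.sum_nonpos fun w _ => hle w
      linarith
    have hneg : ∀ w, 0 < x w → height h x - h w < 0 := fun w hw => by
      have h1 : c < h w := by
        by_contra! hle
        exact absurd hw (hno w hle).not_gt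
      have : (c : ℝ) + 1 ≤ h w := by exact_mod_cast h1
      linarith
    refine Finset.sum_neg' (fun w _ => ?_) ⟨w, Finset.mem_univ w, mul_neg_of_pos_of_neg hw (hneg w hw)⟩
    rcases (hx.1 w).eq_or_lt with h0 | h0
    · simp [← h0]
    · exact (mul_neg_of_pos_of_neg h0 (hneg w h0)).le
  exact this.ne (sum_mul_height_sub hx)

lemma lowerMoment_pos (hx : x ∈ stdSimplex ℝ W) (h1 : c < height h x) (h2 : height h x < c + 1) :
    0 < lowerMoment h c x := by
  obtain ⟨w, hw, hxw⟩ := exists_low hx h2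
  have hle : ∀ w, h w ≤ c → 0 < height h x - h w := fun w hw => by
    have : (h w : ℝ) ≤ c := by exact_mod_cast hw
    linarith
  refine Finset.sum_pos' (fun w _ => ?_) ⟨w, Finset.mem_univ w, ?_⟩
  · unfold lowerPart
    split_ifs with hw
    · exact mul_nonneg (hx.1 w) (hle w hw).le
    · simp
  · simp only [lowerPart, hw, if_true]
    exact mul_pos hxw (hle w hw)

end Height

/-! ### Product structure of a slab between consecutive integral heights -/

section Slab

variable {W : Type} {Γ : SimpleGraph W} {h : W → ℤ} {c : ℤ}

/-- The edges of a graph crossing the slab between heights `c` and `c + 1`. -/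
def SlabVertex (Γ : SimpleGraph W) (h : W → ℤ) (c : ℤ) : Type :=
  {e : W × W // Γ.Adj e.1 e.2 ∧ h e.1 ≤ c ∧ c < h e.2}

lemma SlabVertex.sub_pos (e : SlabVertex Γ h c) : (0 : ℝ) < h e.1.2 - h e.1.1 := by
  have : (h e.1.1 : ℝ) < h e.1.2 := by exact_mod_cast e.2.2.1.trans_lt e.2.2.2
  linarith

/-- The position of the point of height `r` on an edge. -/
noncomputable def crossingTime (h : W → ℤ) (e : W × W) (r : ℝ) : ℝ :=
  (r - h e.1) / (h e.2 - h e.1)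

lemma crossingTime_mem (e : SlabVertex Γ h c) {r : ℝ} (hr : r ∈ Icc (c : ℝ) (c + 1)) :
    crossingTime h e.1 r ∈ Icc (0 : ℝ) 1 := by
  have h1 : (h e.1.1 : ℝ) ≤ c := by exact_mod_cast e.2.2.1
  have h2 : (c : ℝ) + 1 ≤ h e.1.2 := by exact_mod_cast e.2.2.2
  refine ⟨div_nonneg (by linarith [hr.1]) e.sub_pos.le, (div_le_one e.sub_pos).2 ?_⟩
  linarith [hr.2]

variable [Fintype W]

noncomputable instance SlabVertex.instFintype (Γ : SimpleGraph W) (h : W → ℤ) (c : ℤ) : Fintype (SlabVertex Γ h c) := by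
  classical
  exact inferInstanceAs (Fintype {e : W × W // Γ.Adj e.1 e.2 ∧ h e.1 ≤ c ∧ c < h e.2})

/-- The graph of slices of the slab between heights `c` and `c + 1`: crossing edges are adjacent if
they span a simplex. -/
def slabGraph (Γ : SimpleGraph W) (h : W → ℤ) (c : ℤ) : SimpleGraph (SlabVertex Γ h c) where
  Adj e e' := e ≠ e' ∧ ∀ u v, (u = e.1.1 ∨ u = e.1.2 ∨ u = e'.1.1 ∨ u = e'.1.2) →
    (v = e.1.1 ∨ v = e.1.2 ∨ v = e'.1.1 ∨ v = e'.1.2) → u ≠ v → Γ.Adj u v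
  symm := ⟨fun e e' hee => ⟨hee.1.symm, fun u v hu hv => hee.2 u v (by tauto) (by tauto)⟩⟩
  loopless := ⟨fun e he => he.1 rfl⟩

/-- The point at height `r` above the point `x` of the graph of slices. -/
noncomputable def slabPoint (Γ : SimpleGraph W) (h : W → ℤ) (c : ℤ) (x : SlabVertex Γ h c → ℝ)
    (r : ℝ) (w : W) : ℝ :=
  ∑ e, x e * edgePoint e.1.1 e.1.2 (crossingTime h e.1 r) w

/-- The projection of the slab to the graph of slices. -/
noncomputable def slabCoord (Γ : SimpleGraph W) (h : W → ℤ) (c : ℤ) (z : W → ℝ)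
    (e : SlabVertex Γ h c) : ℝ :=
  -- The factor `h e.1.2 - h e.1.1` cancels the denominator of `crossingTime`, and `lowerMoment`
  -- normalizes the total weight to one.
  z e.1.1 * z e.1.2 * ((h e.1.2 - h e.1.1) / lowerMoment h c z)

lemma sum_edgePoint_mul (u v : W) (t : ℝ) (k : W → ℝ) :
    ∑ w, edgePoint u v t w * k w = (1 - t) * k u + t * k v := by
  classical
  simp [edgePoint, add_mul, Finset.sum_add_distrib, indicator_apply]

lemma exists_of_slabPoint_ne_zero {x : SlabVertex Γ h c → ℝ} {r : ℝ} {w : W}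
    (hw : slabPoint Γ h c x r w ≠ 0) : ∃ e, x e ≠ 0 ∧ (w = e.1.1 ∨ w = e.1.2) := by
  obtain ⟨e, -, he⟩ := Finset.exists_ne_zero_of_sum_ne_zero hw
  refine ⟨e, left_ne_zero_of_mul he, ?_⟩
  by_contra! hne
  exact right_ne_zero_of_mul he (by simp [edgePoint, hne.1, hne.2])

lemma adj_of_mem_slab {x : SlabVertex Γ h c → ℝ} (hx : x ∈ oneComplexSet (slabGraph Γ h c))
    {e e' : SlabVertex Γ h c} (he : x e ≠ 0) (he' : x e' ≠ 0) {u v : W}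
    (hu : u = e.1.1 ∨ u = e.1.2) (hv : v = e'.1.1 ∨ v = e'.1.2) (huv : u ≠ v) : Γ.Adj u v := by
  have key : e = e' ∨ (slabGraph Γ h c).Adj e e' := by
    rcases hx.2 with ⟨a, ha⟩ | ⟨a, b, hab, hs⟩
    · exact Or.inl ((ha he).trans (ha he').symm)
    · rcases hs he with rfl | h1 <;> rcases hs he' with rfl | h2
      · exact Or.inl rfl
      · exact Or.inr (h2 ▸ hab)
      · exact Or.inr (h1 ▸ hab.symm)
      · exact Or.inl (h1.trans h2.symm)
  rcases key with rfl | hadj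
  · have := e.2.1
    rcases hu with rfl | rfl <;> rcases hv with rfl | rfl
    · exact absurd rfl huv
    · exact this
    · exact this.symm
    · exact absurd rfl huv
  · exact hadj.2 u v (by tauto) (by tauto) huv

/-- Each fibre of the slab stays in one simplex, so a map that varies little on simplices varies
little along the slab homotopy. -/
lemma sameSimplex_slabPoint {x : SlabVertex Γ h c → ℝ} (hx : x ∈ oneComplexSet (slabGraph Γ h c))
    (r s : ℝ) : SameSimplex Γ (slabPoint Γ h c x r) (slabPoint Γ h c x s) := by
  intro u v huv hu hv
  obtain ⟨e, he, hue⟩ := hu.elim exists_of_slabPoint_ne_zero exists_of_slabPoint_ne_zero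
  obtain ⟨e', he', hve⟩ := hv.elim exists_of_slabPoint_ne_zero exists_of_slabPoint_ne_zero
  exact adj_of_mem_slab hx he he' hue hve huv

lemma sum_slabPoint_mul (x : SlabVertex Γ h c → ℝ) (r : ℝ) (k : W → ℝ) :
    ∑ w, slabPoint Γ h c x r w * k w
      = ∑ e, x e * ((1 - crossingTime h e.1 r) * k e.1.1 + crossingTime h e.1 r * k e.1.2) := by
  simp only [slabPoint, Finset.sum_mul, mul_assoc]
  rw [Finset.sum_comm]
  simp only [← Finset.mul_sum, sum_edgePoint_mul]

lemma slabPoint_mem {x : SlabVertex Γ h c → ℝ} (hx : x ∈ oneComplexSet (slabGraph Γ h c)) {r : ℝ}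
    (hr : r ∈ Icc (c : ℝ) (c + 1)) : slabPoint Γ h c x r ∈ cliqueComplex Γ := by
  refine ⟨⟨fun w => Finset.sum_nonneg fun e _ => mul_nonneg (hx.1.1 e)
    ((edgePoint_mem (Or.inl e.2.1) (crossingTime_mem e hr)).1.1 w), ?_⟩, fun u v huv hu hv =>
      sameSimplex_slabPoint hx r r u v huv (Or.inl hu) (Or.inl hv)⟩
  have := sum_slabPoint_mul x r fun _ => 1
  simp only [mul_one, sub_add_cancel] at this
  rw [this, hx.1.2]

lemma height_slabPoint {x : SlabVertex Γ h c → ℝ} (hx : x ∈ oneComplexSet (slabGraph Γ h c))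
    (r : ℝ) : height h (slabPoint Γ h c x r) = r := by
  have key : ∀ e : SlabVertex Γ h c, (1 - crossingTime h e.1 r) * (h e.1.1 : ℝ)
      + crossingTime h e.1 r * h e.1.2 = r := fun e => by
    have := e.sub_pos.ne'
    unfold crossingTime
    field_simp
    ring
  have := sum_slabPoint_mul x r fun w => (h w : ℝ)
  simp only [key, ← Finset.sum_mul, hx.1.2, one_mul] at this
  exact this

lemma continuous_slabPoint :
    Continuous fun z : (SlabVertex Γ h c → ℝ) × ℝ => slabPoint Γ h c z.1 z.2 := by
  classical
  refine continuous_pi fun w => continuous_finsetSum _ fun e _ => ?_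
  refine ((continuous_apply e).comp continuous_fst).mul ?_
  simp only [edgePoint, crossingTime, indicator_apply]
  refine Continuous.add ?_ ?_ <;> split_ifs <;> fun_prop

/-- Non-adjacent pairs contribute nothing, since `z` never charges both of their vertices. Sums over
crossing edges thus become full double sums, which can be factored. -/
lemma sum_slabVertex {z : W → ℝ} (hz : z ∈ cliqueComplex Γ) (k : W → W → ℝ) :
    ∑ e : SlabVertex Γ h c, z e.1.1 * z e.1.2 * k e.1.1 e.1.2
      = ∑ p, ∑ q, lowerPart h c z p * upperPart h c z q * k p q := by
  classical
  rw [← Fintype.sum_prod_type' (f := fun p q => lowerPart h c z p * upperPart h c z q * k p q)]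
  have := Finset.sum_subtype (p := fun e : W × W => Γ.Adj e.1 e.2 ∧ h e.1 ≤ c ∧ c < h e.2)
    (F := SlabVertex.instFintype Γ h c)
    (Finset.univ.filter fun e : W × W => Γ.Adj e.1 e.2 ∧ h e.1 ≤ c ∧ c < h e.2) (by simp)
    (fun e => z e.1 * z e.2 * k e.1 e.2)
  refine Eq.trans ?_ (this.symm.trans ?_)
  · rfl
  rw [Finset.sum_filter]
  refine Finset.sum_congr rfl fun e _ => ?_
  unfold lowerPart upperPart
  by_cases h1 : h e.1 ≤ c
  · by_cases h2 : h e.2 ≤ c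
    · simp [h2, h2.not_gt]
    · by_cases h3 : Γ.Adj e.1 e.2
      · simp [h1, h2, h3, not_le.1 h2]
      · have hne : e.1 ≠ e.2 := fun heq => h2 (heq ▸ h1)
        have : z e.1 = 0 ∨ z e.2 = 0 := by
          by_contra! hno
          exact h3 (hz.2 _ _ hne hno.1 hno.2)
        rcases this with h0 | h0 <;> simp [h0, h3]
  · simp [h1]

/-- The total weight is computed by splitting `h q - h p` at the height of `z` and using the balance
of moments. -/
lemma slabCoord_mem (hΓ : ∀ s : Finset W, (∀ u ∈ s, ∀ v ∈ s, u ≠ v → Γ.Adj u v) → s.card ≤ 3)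
    {z : W → ℝ} (hz : z ∈ cliqueComplex Γ) (h1 : c < height h z) (h2 : height h z < c + 1) :
    slabCoord Γ h c z ∈ oneComplexSet (slabGraph Γ h c) := by
  classical
  have hS := lowerMoment_pos hz.1 h1 h2
  have hne : ∀ {e : SlabVertex Γ h c}, slabCoord Γ h c z e ≠ 0 → z e.1.1 ≠ 0 ∧ z e.1.2 ≠ 0 :=
    fun he => ⟨left_ne_zero_of_mul (left_ne_zero_of_mul he),
      right_ne_zero_of_mul (left_ne_zero_of_mul he)⟩
  refine mem_oneComplexSet_of_card_le ⟨fun e => ?_, ?_⟩ (fun e e' hee he he' => ⟨hee, ?_⟩)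
    (T := Finset.univ.filter fun e => slabCoord Γ h c z e ≠ 0) (by simp) ?_
  · exact mul_nonneg (mul_nonneg (hz.1.1 _) (hz.1.1 _)) (div_nonneg e.sub_pos.le hS.le)
  · refine (sum_slabVertex hz fun p q => ((h q : ℝ) - h p) / lowerMoment h c z).trans ?_
    have : ∀ p q, lowerPart h c z p * upperPart h c z q * (((h q : ℝ) - h p) / lowerMoment h c z)
        = (lowerPart h c z p * (upperPart h c z q * (h q - height h z))
          + lowerPart h c z p * (height h z - h p) * upperPart h c z q) / lowerMoment h c z :=
      fun p q => by ring
    simp only [this, ← Finset.sum_div, Finset.sum_add_distrib, ← Finset.mul_sum, ← Finset.sum_mul,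
      lowerMoment_eq hz.1]
    rw [show ∑ w, lowerPart h c z w * (height h z - h w) = lowerMoment h c z from rfl,
      mul_comm, ← mul_add, ← Finset.sum_add_distrib]
    simp only [lowerPart_add_upperPart, hz.1.2, mul_one]
    exact div_self hS.ne'
  · rintro u v hu hv huv
    obtain ⟨a1, a2⟩ := hne he
    obtain ⟨b1, b2⟩ := hne he'
    refine hz.2 u v huv ?_ ?_
    · rcases hu with rfl | rfl | rfl | rfl <;> assumption
    · rcases hv with rfl | rfl | rfl | rfl <;> assumption
  -- Crossing edges in the support lie in `A × B`, and `|A| + |B| ≤ 3` forces `|A| * |B| ≤ 2`. This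
  -- is the use of dimension two.
  · let A := Finset.univ.filter fun w => z w ≠ 0 ∧ h w ≤ c
    let B := Finset.univ.filter fun w => z w ≠ 0 ∧ c < h w
    have hAB : (A ∪ B).card ≤ 3 := hΓ _ fun u hu v hv huv => by
      refine hz.2 u v huv ?_ ?_
      · rcases Finset.mem_union.1 hu with hu | hu <;> exact (Finset.mem_filter.1 hu).2.1
      · rcases Finset.mem_union.1 hv with hu | hu <;> exact (Finset.mem_filter.1 hu).2.1
    rw [Finset.card_union_of_disjoint (Finset.disjoint_left.2 fun w hA hB =>
      absurd (Finset.mem_filter.1 hA).2.2 (Finset.mem_filter.1 hB).2.2.not_ge)] at hAB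
    have hle : (Finset.univ.filter fun e : SlabVertex Γ h c => slabCoord Γ h c z e ≠ 0).card
        ≤ (A ×ˢ B).card := by
      refine Finset.card_le_card_of_injOn (fun e => e.1) (fun e he => ?_)
        (fun e _ e' _ hee => Subtype.ext hee)
      have he := (Finset.mem_filter.1 (Finset.mem_coe.1 he)).2
      exact Finset.mem_coe.2 (Finset.mem_product.2
        ⟨Finset.mem_filter.2 ⟨Finset.mem_univ _, (hne he).1, e.2.2.1⟩,
        Finset.mem_filter.2 ⟨Finset.mem_univ _, (hne he).2, e.2.2.2⟩⟩)
    rw [Finset.card_product] at hle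
    refine hle.trans ?_
    have hA3 : A.card ≤ 3 := by omega
    have hB3 : B.card ≤ 3 := by omega
    interval_cases A.card <;> interval_cases B.card <;> omega

/-- A lower vertex `p` receives `z p * (∑ q, z q * (h q - height h z)) / lowerMoment h c z`, the sum
being over upper vertices; by `lowerMoment_eq` this is `z p`. Upper vertices are symmetric. -/
lemma slabPoint_slabCoord {z : W → ℝ} (hz : z ∈ cliqueComplex Γ) (h1 : c < height h z)
    (h2 : height h z < c + 1) : slabPoint Γ h c (slabCoord Γ h c z) (height h z) = z := by
  classical
  have hS := lowerMoment_pos hz.1 h1 h2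
  ext w
  let k : W → W → ℝ := fun p q => (indicator {p} (fun _ => (h q : ℝ) - height h z) w +
    indicator {q} (fun _ => height h z - (h p : ℝ)) w) / lowerMoment h c z
  have hterm : ∀ e : SlabVertex Γ h c, slabCoord Γ h c z e *
      edgePoint e.1.1 e.1.2 (crossingTime h e.1 (height h z)) w
      = z e.1.1 * z e.1.2 * k e.1.1 e.1.2 := fun e => by
    have he := e.sub_pos.ne'
    have hS' := hS.ne'
    simp only [slabCoord, edgePoint, crossingTime, k, indicator_apply]
    split_ifs <;> field_simp <;> ring
  unfold slabPoint
  simp only [hterm]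
  rw [sum_slabVertex hz k]
  have hk : ∀ p q, lowerPart h c z p * upperPart h c z q * k p q
      = (indicator {w} (fun _ => lowerPart h c z p) p * (upperPart h c z q * (h q - height h z))
        + lowerPart h c z p * (height h z - h p) * indicator {w} (fun _ => upperPart h c z q) q)
        / lowerMoment h c z := fun p q => by
    simp only [k, indicator_apply, mem_singleton_iff, eq_comm (a := w)]
    split_ifs <;> ring
  simp only [hk, ← Finset.sum_div, Finset.sum_add_distrib, ← Finset.mul_sum, ← Finset.sum_mul,
    lowerMoment_eq hz.1]
  rw [show ∑ w, lowerPart h c z w * (height h z - h w) = lowerMoment h c z from rfl]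
  have e1 : ∑ p, indicator {w} (fun _ => lowerPart h c z p) p = lowerPart h c z w := by
    simp [indicator_apply]
  have e2 : ∑ p, indicator {w} (fun _ => upperPart h c z p) p = upperPart h c z w := by
    simp [indicator_apply]
  rw [e1, e2, mul_comm, ← mul_add, lowerPart_add_upperPart]
  exact mul_div_cancel_left₀ _ hS.ne'

lemma continuousOn_slabCoord :
    ContinuousOn (slabCoord Γ h c)
      {z | z ∈ cliqueComplex Γ ∧ (c : ℝ) < height h z ∧ height h z < c + 1} := by
  refine continuousOn_pi.2 fun e => ?_
  refine ContinuousOn.mul (by fun_prop) (continuousOn_const.div continuous_lowerMoment.continuousOn ?_)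
  exact fun z hz => (lowerMoment_pos hz.1.1 hz.2.1 hz.2.2).ne'

/-- The projection of a level to the vertices of height at most `c`. -/
noncomputable def lowerProj (h : W → ℤ) (c : ℤ) (z : W → ℝ) (w : W) : ℝ :=
  lowerPart h c z w / ∑ v, lowerPart h c z v

lemma sum_lowerPart_pos {z : W → ℝ} (hz : z ∈ stdSimplex ℝ W) (hc : height h z < c + 1) :
    0 < ∑ v, lowerPart h c z v := by
  obtain ⟨w, hw, hzw⟩ := exists_low hz hc
  refine Finset.sum_pos' (fun v _ => lowerPart_nonneg hz v) ⟨w, Finset.mem_univ w, ?_⟩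
  simpa [lowerPart, hw] using hzw

lemma lowerProj_ne_zero {z : W → ℝ} {w : W} (hw : lowerProj h c z w ≠ 0) : z w ≠ 0 ∧ h w ≤ c := by
  have : lowerPart h c z w ≠ 0 := fun h0 => hw (by simp [lowerProj, h0])
  unfold lowerPart at this
  split_ifs at this with hc
  · exact ⟨this, hc⟩
  · exact absurd rfl this

/-- If three vertices survived, all vertices carrying `z` would have height at most `c` and mean
height `c`. They would all have height `c`, contrary to `hh`. -/
lemma lowerProj_mem (hΓ : ∀ s : Finset W, (∀ u ∈ s, ∀ v ∈ s, u ≠ v → Γ.Adj u v) → s.card ≤ 3)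
    (hh : ∀ u v, Γ.Adj u v → h u ≠ h v) {z : W → ℝ} (hz : z ∈ cliqueComplex Γ)
    (hc : height h z = c) : lowerProj h c z ∈ oneComplexSet Γ := by
  classical
  have hpos := sum_lowerPart_pos hz.1 (c := c) (h := h) (by rw [hc]; linarith)
  refine mem_oneComplexSet_of_card_le ⟨fun w => ?_, ?_⟩ (fun u v huv hu hv =>
    hz.2 u v huv (lowerProj_ne_zero hu).1 (lowerProj_ne_zero hv).1)
    (T := Finset.univ.filter fun w => lowerProj h c z w ≠ 0) (by simp) ?_
  · exact div_nonneg (lowerPart_nonneg hz.1 w) hpos.le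
  · simp only [lowerProj, ← Finset.sum_div]
    exact div_self hpos.ne'
  · let T := Finset.univ.filter fun w => lowerProj h c z w ≠ 0
    let U := Finset.univ.filter fun w => z w ≠ 0
    have hTU : T ⊆ U := fun w hw => Finset.mem_filter.2
      ⟨Finset.mem_univ _, (lowerProj_ne_zero (Finset.mem_filter.1 hw).2).1⟩
    have hU : U.card ≤ 3 := hΓ _ fun u hu v hv huv =>
      hz.2 u v huv (Finset.mem_filter.1 hu).2 (Finset.mem_filter.1 hv).2
    by_contra! h3
    have hT : T = U := Finset.eq_of_subset_of_card_le hTU (by change 2 < T.card at h3; omega)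
    have hlow : ∀ w, z w ≠ 0 → (h w : ℝ) ≤ c := fun w hw => by
      have : w ∈ T := hT ▸ Finset.mem_filter.2 ⟨Finset.mem_univ _, hw⟩
      exact_mod_cast (lowerProj_ne_zero (Finset.mem_filter.1 this).2).2
    have hzero : ∀ w ∈ Finset.univ, z w * (height h z - h w) = 0 := by
      refine (Finset.sum_eq_zero_iff_of_nonneg fun w _ => ?_).1 (sum_mul_height_sub hz.1)
      by_cases hw : z w = 0
      · simp [hw]
      · exact mul_nonneg (hz.1.1 w) (by rw [hc]; linarith [hlow w hw])
    have heq : ∀ w ∈ T, h w = c := fun w hw => by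
      have hw' : z w ≠ 0 := (lowerProj_ne_zero (Finset.mem_filter.1 hw).2).1
      have := (mul_eq_zero.1 (hzero w (Finset.mem_univ w))).resolve_left hw'
      rw [hc] at this
      exact_mod_cast (sub_eq_zero.1 this).symm
    obtain ⟨u, hu, v, hv, huv⟩ := Finset.one_lt_card.1 (show 1 < T.card from by
      change 2 < T.card at h3; omega)
    refine hh u v (hz.2 u v huv ?_ ?_) ((heq u hu).trans (heq v hv).symm)
    · exact (lowerProj_ne_zero (Finset.mem_filter.1 hu).2).1
    · exact (lowerProj_ne_zero (Finset.mem_filter.1 hv).2).1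

lemma continuousOn_lowerProj :
    ContinuousOn (lowerProj h c) {z | z ∈ stdSimplex ℝ W ∧ height h z < c + 1} := by
  refine continuousOn_pi.2 fun w => ContinuousOn.div (continuous_lowerPart w).continuousOn
    (continuous_finsetSum _ fun v _ => continuous_lowerPart v).continuousOn ?_
  exact fun z hz => (sum_lowerPart_pos hz.1 hz.2).ne'

lemma sameSimplex_lowerProj {z : W → ℝ} (hz : z ∈ cliqueComplex Γ) :
    SameSimplex Γ (lowerProj h c z) z := fun u v huv hu hv =>
  hz.2 u v huv (hu.elim (fun h => (lowerProj_ne_zero h).1) id)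
    (hv.elim (fun h => (lowerProj_ne_zero h).1) id)

end Slab

/-! ### Integral levels and gluing across slabs -/

section Glue

variable {W : Type} [Fintype W] {Γ : SimpleGraph W} {h : W → ℤ}

lemma oneComplexSet_subset_cliqueComplex : oneComplexSet Γ ⊆ cliqueComplex Γ := by
  rintro x ⟨hx, hs⟩
  refine ⟨hx, fun u v huv hu hv => ?_⟩
  rcases hs with ⟨a, ha⟩ | ⟨a, b, hab, hs⟩
  · exact absurd ((ha hu).trans (ha hv).symm) huv
  · rcases hs hu with rfl | h1 <;> rcases hs hv with rfl | h2
    · exact absurd rfl huv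
    · exact h2 ▸ hab
    · exact h1 ▸ hab.symm
    · exact absurd (h1.trans h2.symm) huv

/-- The points of the complex of integral height. -/
def integralLevels (Γ : SimpleGraph W) (h : W → ℤ) : Set (cliqueComplex Γ) :=
  {z | ∃ c : ℤ, height h z = c}

lemma isClosed_integralLevels : IsClosed (integralLevels Γ h) := by
  have : integralLevels Γ h = (fun z : cliqueComplex Γ => height h z) ⁻¹' range ((↑) : ℤ → ℝ) := by
    ext z
    simp [integralLevels, eq_comm]
  rw [this]
  exact Int.isClosedEmbedding_coe_real.isClosed_range.preimage
    ((continuous_height h).comp continuous_subtype_val)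

/-- The projections on the various levels fit together continuously because integral heights are
isolated: near a given point the floor is constant. -/
lemma exists_integralLevels_proj
    (hΓ : ∀ s : Finset W, (∀ u ∈ s, ∀ v ∈ s, u ≠ v → Γ.Adj u v) → s.card ≤ 3)
    (hh : ∀ u v, Γ.Adj u v → h u ≠ h v) :
    ∃ ψ : C(integralLevels Γ h, OneComplex Γ), ∀ z, SameSimplex Γ (ψ z) z.1.1 := by
  have hfloor : ∀ z : integralLevels Γ h, height h z.1.1 = ⌊height h z.1.1⌋ := by
    rintro ⟨z, c, hc⟩
    simp only [hc, Int.floor_intCast]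
  refine ⟨⟨fun z => ⟨lowerProj h ⌊height h z.1.1⌋ z.1.1, lowerProj_mem hΓ hh z.1.2 (hfloor z)⟩, ?_⟩,
    fun z => sameSimplex_lowerProj z.1.2⟩
  refine Continuous.subtype_mk (continuous_iff_continuousAt.2 fun z₀ => ?_) _
  set c := ⌊height h z₀.1.1⌋ with hc
  have hcoe : Continuous fun z : integralLevels Γ h => z.1.1 :=
    continuous_subtype_val.comp continuous_subtype_val
  have hcont : Continuous fun z : integralLevels Γ h => height h z.1.1 :=
    (continuous_height h).comp hcoe
  have hlt : ∀ᶠ z : integralLevels Γ h in 𝓝 z₀, height h z.1.1 < c + 1 :=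
    hcont.continuousAt.eventually_lt continuousAt_const (Int.lt_floor_add_one _)
  have hgt : ∀ᶠ z : integralLevels Γ h in 𝓝 z₀, (c : ℝ) - 1 < height h z.1.1 :=
    continuousAt_const.eventually_lt hcont.continuousAt (by
      change (c : ℝ) - 1 < _
      rw [hfloor z₀]; linarith)
  have h1 : Tendsto (fun z : integralLevels Γ h => lowerProj h c z.1.1) (𝓝 z₀)
      (𝓝 (lowerProj h c z₀.1.1)) := by
    have := continuousOn_lowerProj (h := h) (c := c) z₀.1.1
      ⟨z₀.1.2.1, Int.lt_floor_add_one _⟩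
    exact this.tendsto.comp (tendsto_nhdsWithin_iff.2 ⟨hcoe.continuousAt,
      hlt.mono fun z hz => ⟨z.1.2.1, hz⟩⟩)
  refine h1.congr' ?_
  filter_upwards [hlt, hgt] with z h2 h3
  have : ⌊height h z.1.1⌋ = c := by
    rw [hfloor z] at h2 h3
    have h2' : ⌊height h z.1.1⌋ < c + 1 := by exact_mod_cast h2
    have h3' : c - 1 < ⌊height h z.1.1⌋ := by exact_mod_cast h3
    omega
  rw [this]

/-- The homotopy of the graph of slices given by the restriction of a map to a slab. -/
noncomputable def slabHomotopy {X : Type*} [TopologicalSpace X] (F : C(cliqueComplex Γ, X))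
    (h : W → ℤ) (c : ℤ) : C(OneComplex (slabGraph Γ h c) × unitInterval, X) where
  toFun z := F ⟨slabPoint Γ h c z.1 (c + z.2),
    slabPoint_mem z.1.2 ⟨by linarith [z.2.2.1], by linarith [z.2.2.2]⟩⟩
  continuous_toFun := F.continuous.comp (Continuous.subtype_mk
    (continuous_slabPoint.comp (f := fun z : OneComplex (slabGraph Γ h c) × unitInterval =>
      (z.1.1, (c : ℝ) + z.2)) (by fun_prop)) _)

/-- Ribbons over the slabs fit together. -/
lemma exists_glued_ribbons {X : Type*} [MetricSpace X]
    (hΓ : ∀ s : Finset W, (∀ u ∈ s, ∀ v ∈ s, u ≠ v → Γ.Adj u v) → s.card ≤ 3)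
    (F : C(cliqueComplex Γ, X)) {ε : ℝ} (η : ℤ → ℝ) (hη : ∀ c, 0 < η c)
    (u : ∀ c : ℤ, OneComplex (slabGraph Γ h c) × ℝ → X × ℝ)
    (hcont : ∀ c, ContinuousOn (u c) (univ ×ˢ Icc 0 1))
    (hu : ∀ c, ∀ x, ∀ t ∈ Icc (0 : ℝ) 1,
      (x, t, u c (x, t)) ∈ ribbonNhd (slabHomotopy F h c) ε (η c)) :
    ∃ f : C(cliqueComplex Γ, X × ℝ), (∀ (c : ℤ) (z : cliqueComplex Γ), height h z = c →
        f z = (F z, height h z)) ∧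
      ∀ (c : ℤ) (z : cliqueComplex Γ), c < height h z → height h z < c + 1 →
        ∃ x : OneComplex (slabGraph Γ h c), ∃ t ∈ Ioo (0 : ℝ) 1,
          f z = ((u c (x, t)).1, c + (u c (x, t)).2) ∧ slabPoint Γ h c x (c + t) = z := by
  classical
  let Ψ : ∀ (c : ℤ) (z : cliqueComplex Γ), (c < height h z ∧ height h z < c + 1) →
      OneComplex (slabGraph Γ h c) := fun c z hz =>
    ⟨slabCoord Γ h c z, slabCoord_mem hΓ z.2 hz.1 hz.2⟩
  let f : cliqueComplex Γ → X × ℝ := fun z =>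
    if hz : (⌊height h z⌋ : ℝ) < height h z ∧ height h z < ⌊height h z⌋ + 1 then
      ((u ⌊height h z⌋ (Ψ _ z hz, height h z - ⌊height h z⌋)).1,
        ⌊height h z⌋ + (u ⌊height h z⌋ (Ψ _ z hz, height h z - ⌊height h z⌋)).2)
    else (F z, height h z)
  have hf : ∀ (c : ℤ) (z : cliqueComplex Γ) (hz : c < height h z ∧ height h z < c + 1),
      f z = ((u c (Ψ c z hz, height h z - c)).1, c + (u c (Ψ c z hz, height h z - c)).2) := by
    intro c z hz
    obtain rfl : ⌊height h z⌋ = c := Int.floor_eq_iff.2 ⟨hz.1.le, hz.2⟩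
    exact dif_pos hz
  have hf0 : ∀ (c : ℤ) (z : cliqueComplex Γ), height h z = c → f z = (F z, height h z) := by
    intro c z hz
    refine dif_neg fun hlt => ?_
    rw [hz, Int.floor_intCast] at hlt
    exact lt_irrefl _ hlt.1
  have hΨ : ∀ (c : ℤ) (z : cliqueComplex Γ) (hz : c < height h z ∧ height h z < c + 1),
      slabPoint Γ h c (Ψ c z hz) (c + (height h z - c)) = z := by
    intro c z hz
    rw [add_sub_cancel]
    exact slabPoint_slabCoord z.2 hz.1 hz.2
  -- Slab coordinates need not extend continuously to integral heights. Continuity there comes from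
  -- the ribbons being given exactly by `F` near their ends, so that `f` equals `(F, height)` on
  -- both sides.
  have hend : ∀ (c : ℤ) (z : cliqueComplex Γ) (hz : c < height h z ∧ height h z < c + 1),
      (height h z - c < η c ∨ 1 - η c < height h z - c) → f z = (F z, height h z) := by
    intro c z hz hlt
    have ht : height h z - c ∈ Icc (0 : ℝ) 1 := ⟨by linarith, by linarith⟩
    have := (hu c (Ψ c z hz) _ ht).2 ⟨_, ht⟩ rfl hlt
    simp only at this
    rw [hf c z hz, this]
    refine Prod.ext ?_ (add_sub_cancel _ _)
    change F _ = F z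
    congr 1
    exact Subtype.ext (hΨ c z hz)
  have hH : Continuous fun z : cliqueComplex Γ => height h z :=
    (continuous_height h).comp continuous_subtype_val
  have hfc : Continuous f := by
    refine continuous_iff_continuousAt.2 fun z₀ => ?_
    by_cases hz₀ : ∃ c : ℤ, height h z₀ = c
    · obtain ⟨c, hc⟩ := hz₀
      have h1 : ∀ᶠ z : cliqueComplex Γ in 𝓝 z₀, height h z < c + min 1 (η c) :=
        hH.continuousAt.eventually_lt continuousAt_const (by
          have : 0 < min 1 (η c) := lt_min one_pos (hη c)
          rw [hc]; linarith)
      have h2 : ∀ᶠ z : cliqueComplex Γ in 𝓝 z₀, c - min 1 (η (c - 1)) < height h z :=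
        continuousAt_const.eventually_lt hH.continuousAt (by
          have : 0 < min 1 (η (c - 1)) := lt_min one_pos (hη _)
          rw [hc]; linarith)
      have h3 : ContinuousAt (fun z : cliqueComplex Γ => (F z, height h z)) z₀ :=
        (F.continuous.prodMk hH).continuousAt
      refine h3.congr ?_
      filter_upwards [h1, h2] with z h1 h2
      have h5 := min_le_left 1 (η c)
      have h6 := min_le_right 1 (η c)
      have h7 := min_le_left 1 (η (c - 1))
      have h8 := min_le_right 1 (η (c - 1))
      rcases lt_trichotomy (height h z) (c : ℝ) with h4 | h4 | h4
      · exact (hend (c - 1) z ⟨by push_cast; linarith, by push_cast; linarith⟩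
          (Or.inr (by push_cast; linarith))).symm
      · exact (hf0 c z h4).symm
      · exact (hend c z ⟨h4, by linarith⟩ (Or.inl (by linarith))).symm
    · set c := ⌊height h z₀⌋ with hc
      let U : Set (cliqueComplex Γ) := {z | c < height h z ∧ height h z < c + 1}
      have hU : IsOpen U := (isOpen_lt continuous_const hH).inter (isOpen_lt hH continuous_const)
      have hzU : z₀ ∈ U := ⟨lt_of_le_of_ne (Int.floor_le _) fun h => hz₀ ⟨c, h.symm⟩,
        Int.lt_floor_add_one _⟩
      have hfU : ContinuousOn f U := by
        rw [continuousOn_iff_continuous_domRestrict]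
        have e : U.domRestrict f = fun z : U => ((u c (Ψ c z z.2, height h z.1 - c)).1,
            c + (u c (Ψ c z z.2, height h z.1 - c)).2) := funext fun z => hf c z z.2
        rw [e]
        have hHU : Continuous fun z : U => height h z.1 := hH.comp continuous_subtype_val
        have hΨc : Continuous fun z : U => Ψ c z z.2 :=
          Continuous.subtype_mk (continuousOn_slabCoord.comp_continuous
            (continuous_subtype_val.comp continuous_subtype_val) fun z => ⟨z.1.2, z.2⟩) _
        have huc : Continuous fun z : U => u c (Ψ c z z.2, height h z.1 - c) :=
          (hcont c).comp_continuous (hΨc.prodMk (hHU.sub continuous_const)) fun z =>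
            ⟨mem_univ _, by linarith [z.2.1], by linarith [z.2.2]⟩
        exact huc.fst.prodMk (continuous_const.add huc.snd)
      exact hfU.continuousAt (hU.mem_nhds hzU)
  exact ⟨⟨f, hfc⟩, hf0, fun c z h1 h2 => ⟨Ψ c z ⟨h1, h2⟩, height h z - c,
    ⟨by linarith, by linarith⟩, hf c z ⟨h1, h2⟩, hΨ c z ⟨h1, h2⟩⟩⟩

end Glue

/-! ### Disjoint approximations for maps of complexes -/

lemma TightAt.mem_Ioo {K X : Type*} [TopologicalSpace K] [TopologicalSpace X] {k₀ k₁ : K → X}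
    {M : Set (K × ℝ × X × ℝ)} {u : K × ℝ → X × ℝ} (hu : IsRibbon 0 1 k₀ k₁ M u)
    (h0 : TightAt 0 1 0 u) (h1 : TightAt 0 1 1 u) {x : K} {t : ℝ} (ht : t ∈ Ioo (0 : ℝ) 1) :
    (u (x, t)).2 ∈ Ioo (0 : ℝ) 1 := by
  have ht' : t ∈ Icc (0 : ℝ) 1 := Ioo_subset_Icc_self ht
  have h := (hu.2.2.2 x t ht').1
  exact ⟨lt_of_le_of_ne h.1 fun h => ht.1.ne' (h0 x t ht' h.symm),
    lt_of_le_of_ne h.2 fun h => ht.2.ne (h1 x t ht' h)⟩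

/-- The three `ε` come from the ribbon, from the change of `F` to `F'`, and from moving along a
fibre inside one simplex. The level and the height lie in the same slab, hence differ by at most
one. -/
lemma dist_and_level_of_glued {W : Type} [Fintype W] {Γ : SimpleGraph W} {h : W → ℤ} {X : Type*}
    [MetricSpace X] {F F' : C(cliqueComplex Γ, X)} {ε : ℝ} (hF' : ∀ z, dist (F' z) (F z) < ε)
    (hsame : ∀ x y : cliqueComplex Γ, SameSimplex Γ x.1 y.1 → dist (F x) (F y) < ε) {c : ℤ} {η : ℝ}
    {x : OneComplex (slabGraph Γ h c)} {t : ℝ} {p : X × ℝ} (hp : p.2 ∈ Ioo (0 : ℝ) 1)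
    (hxp : (x, t, p) ∈ ribbonNhd (slabHomotopy F' h c) ε η) {z : cliqueComplex Γ}
    (hz : slabPoint Γ h c x (c + t) = z) (h1 : c < height h z) (h2 : height h z < c + 1) :
    dist p.1 (F z) < 3 * ε ∧ |c + p.2 - height h z| ≤ 1 := by
  refine ⟨?_, abs_le.2 ⟨by linarith [hp.1], by linarith [hp.2]⟩⟩
  obtain ⟨s, hs⟩ := hxp.1
  have hmem := slabPoint_mem x.2 (r := c + s) ⟨by linarith [s.2.1], by linarith [s.2.2]⟩
  have e1 : dist p.1 (F' ⟨_, hmem⟩) < ε := hs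
  have e2 := hF' ⟨_, hmem⟩
  have e3 : dist (F ⟨_, hmem⟩) (F z) < ε := hsame _ _ (by
    rw [← hz]
    exact sameSimplex_slabPoint x.2 _ _)
  linarith [dist_triangle4 p.1 (F' ⟨_, hmem⟩) (F ⟨_, hmem⟩) (F z)]

/-- In an ANR with the fuzzy ribbons property, two maps of clique complexes of dimension at most two
into the product with the line, affine in the last coordinate on each simplex, have disjoint
approximations. -/
theorem exists_disjoint_complex_maps {X : Type u} [MetricSpace X] (hA : IsANR X)
    (hX : FuzzyRibbonsProperty X) {W₁ W₂ : Type} [Fintype W₁] [Fintype W₂] {Γ₁ : SimpleGraph W₁}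
    {Γ₂ : SimpleGraph W₂} {h₁ : W₁ → ℤ} {h₂ : W₂ → ℤ}
    (hΓ₁ : ∀ s : Finset W₁, (∀ u ∈ s, ∀ v ∈ s, u ≠ v → Γ₁.Adj u v) → s.card ≤ 3)
    (hΓ₂ : ∀ s : Finset W₂, (∀ u ∈ s, ∀ v ∈ s, u ≠ v → Γ₂.Adj u v) → s.card ≤ 3)
    (hh₁ : ∀ u v, Γ₁.Adj u v → h₁ u ≠ h₁ v) (hh₂ : ∀ u v, Γ₂.Adj u v → h₂ u ≠ h₂ v)
    (F : C(cliqueComplex Γ₁, X)) (G : C(cliqueComplex Γ₂, X)) {ε δ : ℝ} (hε : 0 < ε) (hδ : 0 < δ)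
    (hFext : ∀ A : Set (cliqueComplex Γ₁), IsClosed A → ∀ g : C(A, X),
      (∀ a : A, dist (g a) (F a) < δ) →
        ∃ F' : C(cliqueComplex Γ₁, X), (∀ a : A, F' a = g a) ∧ ∀ z, dist (F' z) (F z) < ε)
    (hGext : ∀ A : Set (cliqueComplex Γ₂), IsClosed A → ∀ g : C(A, X),
      (∀ a : A, dist (g a) (G a) < δ) →
        ∃ G' : C(cliqueComplex Γ₂, X), (∀ a : A, G' a = g a) ∧ ∀ z, dist (G' z) (G z) < ε)
    (hF : ∀ x y : cliqueComplex Γ₁, SameSimplex Γ₁ x.1 y.1 → dist (F x) (F y) < min ε (δ / 2))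
    (hG : ∀ x y : cliqueComplex Γ₂, SameSimplex Γ₂ x.1 y.1 → dist (G x) (G y) < min ε (δ / 2)) :
    ∃ (f : C(cliqueComplex Γ₁, X × ℝ)) (g : C(cliqueComplex Γ₂, X × ℝ)),
      (∀ z, dist (f z).1 (F z) < 3 * ε ∧ |(f z).2 - height h₁ z| ≤ 1) ∧
      (∀ z, dist (g z).1 (G z) < 3 * ε ∧ |(g z).2 - height h₂ z| ≤ 1) ∧ ∀ z w, f z ≠ g w := by
  obtain ⟨ψ₁, hψ₁⟩ := exists_integralLevels_proj hΓ₁ hh₁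
  obtain ⟨ψ₂, hψ₂⟩ := exists_integralLevels_proj hΓ₂ hh₂
  let ι₁ : C(OneComplex Γ₁, cliqueComplex Γ₁) :=
    ⟨inclusion oneComplexSet_subset_cliqueComplex, continuous_inclusion _⟩
  let ι₂ : C(OneComplex Γ₂, cliqueComplex Γ₂) :=
    ⟨inclusion oneComplexSet_subset_cliqueComplex, continuous_inclusion _⟩
  obtain ⟨φ, γ, hφ, hγ, hne⟩ := exists_disjoint_graph_maps hA hX (F.comp ι₁) (G.comp ι₂)
    (half_pos hδ)
  obtain ⟨F', hF'A, hF'⟩ := hFext _ isClosed_integralLevels (φ.comp ψ₁) fun a => by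
    have e1 : dist (φ (ψ₁ a)) (F (ι₁ (ψ₁ a))) < δ / 2 := hφ _
    have e2 := (hF (ι₁ (ψ₁ a)) a (hψ₁ a)).trans_le (min_le_right _ _)
    exact (dist_triangle _ _ _).trans_lt ((add_lt_add e1 e2).trans_eq (add_halves δ))
  obtain ⟨G', hG'A, hG'⟩ := hGext _ isClosed_integralLevels (γ.comp ψ₂) fun a => by
    have e1 : dist (γ (ψ₂ a)) (G (ι₂ (ψ₂ a))) < δ / 2 := hγ _
    have e2 := (hG (ι₂ (ψ₂ a)) a (hψ₂ a)).trans_le (min_le_right _ _)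
    exact (dist_triangle _ _ _).trans_lt ((add_lt_add e1 e2).trans_eq (add_halves δ))
  -- Points at different integral heights are separated as well, as the ends of the slab homotopies
  -- require.
  have hne' : ∀ z ∈ integralLevels Γ₁ h₁, ∀ w ∈ integralLevels Γ₂ h₂, F' z ≠ G' w := by
    intro z hz w hw
    rw [hF'A ⟨z, hz⟩, hG'A ⟨w, hw⟩]
    exact hne _ _
  have hint : ∀ (c : ℤ) (i : unitInterval), i = 0 ∨ i = 1 → ∃ c' : ℤ, (c : ℝ) + i = c' := by
    rintro c i (rfl | rfl)
    · exact ⟨c, by simp⟩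
    · exact ⟨c + 1, by simp⟩
  have hslab := fun c : ℤ => exists_separated_ribbonNhd hA hX (slabHomotopy F' h₁ c)
    (slabHomotopy G' h₂ c) (fun x y i j hi hj => by
      obtain ⟨c₁, hc₁⟩ := hint c i hi
      obtain ⟨c₂, hc₂⟩ := hint c j hj
      exact hne' _ ⟨c₁, (height_slabPoint x.2 _).trans hc₁⟩ _
        ⟨c₂, (height_slabPoint y.2 _).trans hc₂⟩) hε
  choose η hη u v hu hv huv hL hR using hslab
  obtain ⟨f, hf0, hf⟩ := exists_glued_ribbons hΓ₁ F' η hη u (fun c => (hu c).1)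
    fun c x t ht => ((hu c).2.2.2 x t ht).2
  obtain ⟨g, hg0, hg⟩ := exists_glued_ribbons hΓ₂ G' η hη v (fun c => (hv c).1)
    fun c x t ht => ((hv c).2.2.2 x t ht).2
  have huI : ∀ c x t, t ∈ Ioo (0 : ℝ) 1 → (u c (x, t)).2 ∈ Ioo (0 : ℝ) 1 := fun c x t ht =>
    TightAt.mem_Ioo (hu c) (hL c trivial).1 (hR c trivial).1 ht
  have hvI : ∀ c x t, t ∈ Ioo (0 : ℝ) 1 → (v c (x, t)).2 ∈ Ioo (0 : ℝ) 1 := fun c x t ht =>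
    TightAt.mem_Ioo (hv c) (hL c trivial).2 (hR c trivial).2 ht
  have hcases : ∀ r : ℝ, (∃ c : ℤ, r = c) ∨ ∃ c : ℤ, (c : ℝ) < r ∧ r < c + 1 := fun r => by
    rcases (Int.floor_le r).eq_or_lt with h | h
    · exact Or.inl ⟨_, h.symm⟩
    · exact Or.inr ⟨_, h, Int.lt_floor_add_one r⟩
  refine ⟨f, g, fun z => ?_, fun z => ?_, fun z w hzw => ?_⟩
  · rcases hcases (height h₁ z) with ⟨c, hc⟩ | ⟨c, h1, h2⟩
    · rw [hf0 c z hc]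
      exact ⟨(hF' z).trans (by linarith), by simp⟩
    · obtain ⟨x, t, ht, hfz, hz⟩ := hf c z h1 h2
      rw [hfz]
      exact dist_and_level_of_glued hF' (fun x y hxy => (hF x y hxy).trans_le (min_le_left _ _))
        (huI c x t ht) ((hu c).2.2.2 x t (Ioo_subset_Icc_self ht)).2 hz h1 h2
  · rcases hcases (height h₂ z) with ⟨c, hc⟩ | ⟨c, h1, h2⟩
    · rw [hg0 c z hc]
      exact ⟨(hG' z).trans (by linarith), by simp⟩
    · obtain ⟨x, t, ht, hfz, hz⟩ := hg c z h1 h2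
      rw [hfz]
      exact dist_and_level_of_glued hG' (fun x y hxy => (hG x y hxy).trans_le (min_le_left _ _))
        (hvI c x t ht) ((hv c).2.2.2 x t (Ioo_subset_Icc_self ht)).2 hz h1 h2
  -- By tightness, points inside a slab keep levels strictly inside it. A coincidence must therefore
  -- involve two integral levels or two points of slabs with the same index.
  · have mixed : ∀ (c d : ℤ) (r : ℝ), r ∈ Ioo (0 : ℝ) 1 → (c : ℝ) ≠ d + r := by
      intro c d r hr heq
      have h1 : (d : ℝ) < c := by linarith [hr.1]
      have h2 : (c : ℝ) < d + 1 := by linarith [hr.2]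
      have h1' : d < c := by exact_mod_cast h1
      have h2' : c < d + 1 := by exact_mod_cast h2
      omega
    rcases hcases (height h₁ z) with ⟨c, hc⟩ | ⟨c, h1, h2⟩ <;>
      rcases hcases (height h₂ w) with ⟨d, hd⟩ | ⟨d, h3, h4⟩
    · rw [hf0 c z hc, hg0 d w hd] at hzw
      exact hne' z ⟨c, hc⟩ w ⟨d, hd⟩ (Prod.ext_iff.1 hzw).1
    · obtain ⟨y, t, ht, hgw, -⟩ := hg d w h3 h4
      rw [hf0 c z hc, hgw, hc] at hzw
      exact mixed c d _ (hvI d y t ht) (Prod.ext_iff.1 hzw).2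
    · obtain ⟨x, s, hs, hfz, -⟩ := hf c z h1 h2
      rw [hg0 d w hd, hfz, hd] at hzw
      exact mixed d c _ (huI c x s hs) (Prod.ext_iff.1 hzw).2.symm
    · obtain ⟨x, s, hs, hfz, -⟩ := hf c z h1 h2
      obtain ⟨y, t, ht, hgw, -⟩ := hg d w h3 h4
      rw [hfz, hgw] at hzw
      obtain ⟨e1, e2⟩ := Prod.ext_iff.1 hzw
      simp only at e1 e2
      have hu1 := huI c x s hs
      have hv1 := hvI d y t ht
      have hcd : c = d := by
        have l1 : (c : ℝ) < d + 1 := by linarith [hu1.1, hv1.2]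
        have l2 : (d : ℝ) < c + 1 := by linarith [hu1.2, hv1.1]
        have l1' : c < d + 1 := by exact_mod_cast l1
        have l2' : d < c + 1 := by exact_mod_cast l2
        omega
      subst hcd
      exact huv c x y s (Ioo_subset_Icc_self hs) t (Ioo_subset_Icc_self ht)
        (Prod.ext e1 (add_left_cancel e2))

/-! ### Fine two-dimensional models of the disk -/

/-- A bump function on the line, positive exactly on the interval from `a` to `a + 3`. -/
noncomputable def bump (a y : ℝ) : ℝ := max 0 ((y - a) * (a + 3 - y))

lemma bump_nonneg (a y : ℝ) : 0 ≤ bump a y := le_max_left _ _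

lemma bump_ne_zero {a y : ℝ} : bump a y ≠ 0 ↔ y ∈ Ioo a (a + 3) := by
  constructor
  · intro h
    have hpos : 0 < (y - a) * (a + 3 - y) := by
      by_contra! hle
      exact h (max_eq_left hle)
    rcases mul_pos_iff.1 hpos with ⟨h1, h2⟩ | ⟨h1, h2⟩
    · exact ⟨by linarith, by linarith⟩
    · linarith
  · rintro ⟨h1, h2⟩
    exact (lt_max_of_lt_right (mul_pos (by linarith) (by linarith))).ne'

lemma eq_of_mem_Ioo_three {k : ℝ} {i j : ℤ} {y : ℝ} (hi : y ∈ Ioo (k + 3 * i) (k + 3 * i + 3))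
    (hj : y ∈ Ioo (k + 3 * j) (k + 3 * j + 3)) : i = j := by
  have h1 : (i : ℝ) < j + 1 := by linarith [hi.1, hj.2]
  have h2 : (j : ℝ) < i + 1 := by linarith [hi.2, hj.1]
  have h1' : i < j + 1 := by exact_mod_cast h1
  have h2' : j < i + 1 := by exact_mod_cast h2
  omega

/-- Two real numbers avoid a common class of `ℤ` modulo three. -/
lemma exists_class_avoiding (y y' : ℝ) :
    ∃ k : Fin 3, (∀ i : ℤ, y ≠ (k : ℕ) + 3 * i) ∧ ∀ i : ℤ, y' ≠ (k : ℕ) + 3 * i := by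
  have uniq : ∀ (y : ℝ) (k k' : Fin 3) (i i' : ℤ), y = (k : ℕ) + 3 * i → y = (k' : ℕ) + 3 * i' →
      k = k' := by
    intro y k k' i i' h h'
    have : ((k : ℕ) : ℤ) + 3 * i = ((k' : ℕ) : ℤ) + 3 * i' := by
      have := h.symm.trans h'
      exact_mod_cast this
    exact Fin.ext (by omega)
  -- Each of the two numbers lies in at most one residue class, so of three classes one is free.
  by_contra! hno
  have hbad : ∀ k : Fin 3, (∃ i : ℤ, y = (k : ℕ) + 3 * i) ∨ ∃ i : ℤ, y' = (k : ℕ) + 3 * i :=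
    fun k => by
      by_contra! h
      obtain ⟨i, hi⟩ := hno k h.1
      exact h.2 i hi
  have two : ∀ (y : ℝ) (k k' : Fin 3), k ≠ k' → (∃ i : ℤ, y = (k : ℕ) + 3 * i) →
      (∃ i : ℤ, y = (k' : ℕ) + 3 * i) → False := fun y k k' hk ⟨i, hi⟩ ⟨i', hi'⟩ =>
    hk (uniq y k k' i i' hi hi')
  rcases hbad 0 with h0 | h0 <;> rcases hbad 1 with h1 | h1 <;> rcases hbad 2 with h2 | h2
  all_goals first
    | exact two _ 0 1 (by decide) h0 h1
    | exact two _ 0 2 (by decide) h0 h2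
    | exact two _ 1 2 (by decide) h1 h2

lemma exists_mem_Ioo_three {y k : ℝ} {N : ℕ} (hk : 0 ≤ k) (hk' : k ≤ 2) (hy : |y| ≤ N)
    (h : ∀ i : ℤ, y ≠ k + 3 * i) :
    ∃ i ∈ Finset.Icc (-(N + 3) : ℤ) (N + 3), y ∈ Ioo (k + 3 * i) (k + 3 * i + 3) := by
  obtain ⟨hy1, hy2⟩ := abs_le.1 hy
  have h1 := Int.floor_le ((y - k) / 3)
  have h2 := Int.lt_floor_add_one ((y - k) / 3)
  set i := ⌊(y - k) / 3⌋
  have h3 : k + 3 * i ≤ y := by linarith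
  refine ⟨i, Finset.mem_Icc.2 ⟨?_, ?_⟩, lt_of_le_of_ne h3 (h i).symm, by linarith⟩
  · have : (-(N + 3) : ℝ) ≤ i := by
      have : (0 : ℝ) ≤ N := Nat.cast_nonneg N
      linarith
    exact_mod_cast this
  · have : (i : ℝ) ≤ N + 3 := by
      have : (0 : ℝ) ≤ N := Nat.cast_nonneg N
      linarith
    exact_mod_cast this

lemma disk_dist_le (z w : Disk 2) : dist z w ≤ |z.1 0 - w.1 0| + |z.1 1 - w.1 1| := by
  rw [Subtype.dist_eq, EuclideanSpace.dist_eq, Fin.sum_univ_two]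
  refine Real.sqrt_le_iff.2 ⟨by positivity, ?_⟩
  rw [Real.dist_eq, Real.dist_eq]
  nlinarith [abs_nonneg (z.1 0 - w.1 0), abs_nonneg (z.1 1 - w.1 1)]

/-- The disk has fine partitions of unity, indexed by a set with three colours such that functions
with the same colour have disjoint supports. -/
lemma exists_coloured_partition {δ : ℝ} (hδ : 0 < δ) :
    ∃ (W : Type) (_ : Fintype W) (col : W → Fin 3) (c : W → Disk 2) (μ : W → C(Disk 2, ℝ)),
      (∀ w z, 0 ≤ μ w z) ∧ (∀ z, ∑ w, μ w z = 1) ∧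
      (∀ u v z, u ≠ v → μ u z ≠ 0 → μ v z ≠ 0 → col u ≠ col v) ∧
      ∀ w z, μ w z ≠ 0 → dist z (c w) < δ := by
  classical
  -- Colour `k` consists of the open squares of a grid of mesh `3`, shifted by `k` in both
  -- coordinates after scaling by `N`. A point lies on the grid lines of at most two colours, so the
  -- three colours cover. Points of one square are at distance less than `6 / N`.
  obtain ⟨N, hN⟩ := exists_nat_gt (6 / δ)
  have hN0 : (0 : ℝ) < N := (div_pos (by norm_num) hδ).trans hN
  have hNδ : 6 < N * δ := (div_lt_iff₀ hδ).1 hN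
  let W := Fin 3 × {i : ℤ // i ∈ Finset.Icc (-(N + 3) : ℤ) (N + 3)} ×
    {i : ℤ // i ∈ Finset.Icc (-(N + 3) : ℤ) (N + 3)}
  let _ : Fintype W := inferInstanceAs (Fintype (Fin 3 ×
    {i : ℤ // i ∈ Finset.Icc (-(N + 3) : ℤ) (N + 3)} ×
    {i : ℤ // i ∈ Finset.Icc (-(N + 3) : ℤ) (N + 3)}))
  let ν : W → C(Disk 2, ℝ) := fun w =>
    ⟨fun z => bump ((w.1 : ℕ) + 3 * (w.2.1.1 : ℝ)) (N * z.1 0) *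
      bump ((w.1 : ℕ) + 3 * (w.2.2.1 : ℝ)) (N * z.1 1), by unfold bump; fun_prop⟩
  have hν0 : ∀ w z, 0 ≤ ν w z := fun w z => mul_nonneg (bump_nonneg _ _) (bump_nonneg _ _)
  have hν : ∀ w z, ν w z ≠ 0 ↔
      N * z.1 0 ∈ Ioo ((w.1 : ℕ) + 3 * (w.2.1.1 : ℝ)) ((w.1 : ℕ) + 3 * (w.2.1.1 : ℝ) + 3) ∧
      N * z.1 1 ∈ Ioo ((w.1 : ℕ) + 3 * (w.2.2.1 : ℝ)) ((w.1 : ℕ) + 3 * (w.2.2.1 : ℝ) + 3) :=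
    fun w z => mul_ne_zero_iff.trans (and_congr bump_ne_zero bump_ne_zero)
  have hcoord : ∀ (z : Disk 2) (l : Fin 2), |(N : ℝ) * z.1 l| ≤ N := by
    intro z l
    have h1 : ‖z.1 l‖ ≤ 1 := (PiLp.norm_apply_le z.1 l).trans (mem_closedBall_zero_iff.1 z.2)
    rw [abs_mul, abs_of_pos hN0]
    exact mul_le_of_le_one_right hN0.le h1
  have hsum : ∀ z, 0 < ∑ w, ν w z := by
    intro z
    obtain ⟨k, h0, h1⟩ := exists_class_avoiding (N * z.1 0) (N * z.1 1)
    have hk2 : ((k : ℕ) : ℝ) ≤ 2 := by exact_mod_cast Nat.le_of_lt_succ k.2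
    obtain ⟨i, hi, hyi⟩ := exists_mem_Ioo_three (Nat.cast_nonneg _) hk2 (hcoord z 0) h0
    obtain ⟨j, hj, hyj⟩ := exists_mem_Ioo_three (Nat.cast_nonneg _) hk2 (hcoord z 1) h1
    refine Finset.sum_pos' (fun w _ => hν0 w z) ⟨(k, ⟨i, hi⟩, ⟨j, hj⟩), Finset.mem_univ _, ?_⟩
    exact lt_of_le_of_ne (hν0 _ z) ((hν _ z).2 ⟨hyi, hyj⟩).symm
  have hdiv : ∀ w z, ν w z / ∑ v, ν v z ≠ 0 → ν w z ≠ 0 := fun w z h => (div_ne_zero_iff.1 h).1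
  let c : W → Disk 2 := fun w => if h : ∃ z, ν w z ≠ 0 then h.choose else ⟨0, by simp⟩
  refine ⟨W, inferInstance, fun w => w.1, c, fun w => ⟨fun z => ν w z / ∑ v, ν v z,
    (ν w).continuous.div (continuous_finsetSum _ fun v _ => (ν v).continuous)
      fun z => (hsum z).ne'⟩, fun w z => div_nonneg (hν0 w z) (hsum z).le, fun z => ?_, ?_, ?_⟩
  · change ∑ w, ν w z / ∑ v, ν v z = 1
    rw [← Finset.sum_div]
    exact div_self (hsum z).ne'
  · rintro ⟨k, i, j⟩ ⟨k', i', j'⟩ z hne hu hv (rfl : k = k')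
    have hu := (hν _ z).1 (hdiv _ z hu)
    have hv := (hν _ z).1 (hdiv _ z hv)
    exact hne (Prod.ext rfl (Prod.ext (Subtype.ext (eq_of_mem_Ioo_three hu.1 hv.1))
      (Subtype.ext (eq_of_mem_Ioo_three hu.2 hv.2))))
  · intro w z hz
    have hz' : ν w z ≠ 0 := hdiv w z hz
    have hex : ∃ z, ν w z ≠ 0 := ⟨z, hz'⟩
    have hc : ν w (c w) ≠ 0 := by
      simp only [c, dif_pos hex]
      exact hex.choose_spec
    obtain ⟨⟨a1, a2⟩, a3, a4⟩ := (hν w z).1 hz'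
    obtain ⟨⟨b1, b2⟩, b3, b4⟩ := (hν w (c w)).1 hc
    have d0 : N * |z.1 0 - (c w).1 0| < 3 := by
      rw [show ∀ x : ℝ, N * |x| = |N * x| from fun x => by rw [abs_mul, abs_of_pos hN0], mul_sub]
      exact abs_lt.2 ⟨by linarith, by linarith⟩
    have d1 : N * |z.1 1 - (c w).1 1| < 3 := by
      rw [show ∀ x : ℝ, N * |x| = |N * x| from fun x => by rw [abs_mul, abs_of_pos hN0], mul_sub]
      exact abs_lt.2 ⟨by linarith, by linarith⟩
    refine (disk_dist_le z (c w)).trans_lt (lt_of_mul_lt_mul_left ?_ hN0.le)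
    rw [mul_add]
    linarith

lemma sum_smul_mem_of_convex {W E : Type*} [Fintype W] [AddCommGroup E] [Module ℝ E] {S : Set E}
    (hS : Convex ℝ S) {x : W → ℝ} (hx : x ∈ stdSimplex ℝ W) {c : W → E}
    (hc : ∀ w, x w ≠ 0 → c w ∈ S) : ∑ w, x w • c w ∈ S := by
  rw [← finsum_eq_sum_of_fintype]
  exact hS.finsum_mem hx.1 (by rw [finsum_eq_sum_of_fintype, hx.2]) hc

/-- The disk is approximated by two-dimensional complexes on which a given function is nearly
affine, with heights telling apart the vertices of each simplex. -/
lemma exists_complex_model (k : C(Disk 2, ℝ)) {ρ s : ℝ} (hρ : 0 < ρ) (hs : 0 < s) :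
    ∃ (W : Type) (_ : Fintype W) (Γ : SimpleGraph W) (h : W → ℤ)
      (α : C(Disk 2, cliqueComplex Γ)) (β : C(cliqueComplex Γ, Disk 2)),
      (∀ s : Finset W, (∀ u ∈ s, ∀ v ∈ s, u ≠ v → Γ.Adj u v) → s.card ≤ 3) ∧
      (∀ u v, Γ.Adj u v → h u ≠ h v) ∧ (∀ z, dist (β (α z)) z < ρ) ∧
      (∀ x y : cliqueComplex Γ, SameSimplex Γ x.1 y.1 → dist (β x) (β y) < ρ) ∧
      ∀ z, |s * height h (α z) - k z| ≤ 4 * s := by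
  obtain ⟨ρ', hρ', hk⟩ := Metric.uniformContinuous_iff.1
    (CompactSpace.uniformContinuous_of_continuous k.continuous) s hs
  set δ := min (ρ / 4) ρ' with hδ
  have hδ0 : 0 < δ := by positivity
  have hδρ : 4 * δ ≤ ρ := by linarith [min_le_left (ρ / 4) ρ']
  obtain ⟨W, hW, col, c, μ, hμ0, hμ1, hμc, hμd⟩ := exists_coloured_partition hδ0
  -- Cliques have distinct colours, hence at most three vertices.
  let Γ : SimpleGraph W :=
    { Adj := fun u v => col u ≠ col v ∧ dist (c u) (c v) < 2 * δ
      symm := ⟨fun u v h => ⟨h.1.symm, by rw [dist_comm]; exact h.2⟩⟩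
      loopless := ⟨fun u h => h.1 rfl⟩ }
  -- The residue modulo three is the colour, so adjacent vertices have different heights. Rounding
  -- and colour cost at most `3 * s`, and the variation of `k` near `c w` at most `s` more.
  let h : W → ℤ := fun w => 3 * ⌊k (c w) / (3 * s)⌋ + (col w : ℕ)
  have hμs : ∀ z, (fun w => μ w z) ∈ stdSimplex ℝ W := fun z => ⟨fun w => hμ0 w z, hμ1 z⟩
  let α : C(Disk 2, cliqueComplex Γ) := ⟨fun z => ⟨fun w => μ w z, hμs z, fun u v huv hu hv =>
      ⟨hμc u v z huv hu hv, by
        linarith [dist_triangle_left (c u) (c v) z, hμd u z hu, hμd v z hv]⟩⟩,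
    Continuous.subtype_mk (continuous_pi fun w => (μ w).continuous) _⟩
  let β : C(cliqueComplex Γ, Disk 2) := ⟨fun x => ⟨∑ w, x.1 w • (c w).1,
      sum_smul_mem_of_convex (convex_closedBall _ _) x.2.1 fun w _ => (c w).2⟩,
    Continuous.subtype_mk (continuous_finsetSum _ fun w _ =>
      ((continuous_apply w).comp continuous_subtype_val).smul continuous_const) _⟩
  have hβ : ∀ (x : cliqueComplex Γ) (p : Disk 2) (r : ℝ),
      (∀ w, x.1 w ≠ 0 → dist (c w) p < r) → dist (β x) p < r := fun x p r hx =>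
    sum_smul_mem_of_convex (S := ball p.1 r) (convex_ball _ _) x.2.1 fun w hw => hx w hw
  refine ⟨W, hW, Γ, h, α, β, fun T hT => ?_, fun u v huv heq => ?_, fun z => ?_, fun x y hxy => ?_,
    fun z => ?_⟩
  · have : T.card ≤ (Finset.univ : Finset (Fin 3)).card :=
      Finset.card_le_card_of_injOn col (fun _ _ => by simp) fun u hu v hv huv => by
        by_contra hne
        exact (hT u hu v hv hne).1 huv
    simpa using this
  · refine huv.1 (Fin.ext ?_)
    have h1 := (col u).2
    have h2 := (col v).2
    simp only [h] at heq
    omega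
  · refine hβ _ _ _ fun w hw => ?_
    rw [dist_comm]
    linarith [hμd w z hw]
  · obtain ⟨w, hw⟩ : ∃ w, x.1 w ≠ 0 := by
      by_contra! h0
      have := x.2.1.2
      simp [h0] at this
    have key : ∀ u, (x.1 u ≠ 0 ∨ y.1 u ≠ 0) → dist (c u) (c w) < 2 * δ := fun u hu => by
      by_cases huw : u = w
      · rw [huw, dist_self]
        linarith
      · exact (hxy u w huw hu (Or.inl hw)).2
    linarith [dist_triangle_right (β x) (β y) (c w), hβ x (c w) _ fun u hu => key u (Or.inl hu),
      hβ y (c w) _ fun u hu => key u (Or.inr hu)]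
  · have hmem : height h (α z) ∈ {r : ℝ | s * r ∈ Icc (k z - 4 * s) (k z + 4 * s)} := by
      refine sum_smul_mem_of_convex (S := {r : ℝ | s * r ∈ Icc (k z - 4 * s) (k z + 4 * s)})
        (x := fun w => μ w z) (c := fun w => (h w : ℝ)) ?_ (hμs z) fun w hw => ?_
      · exact (convex_Icc _ _).linear_preimage (LinearMap.mul ℝ ℝ s)
      · have hd : dist (k (c w)) (k z) < s :=
          hk (by rw [dist_comm]; exact (hμd w z hw).trans_le (min_le_right _ _))
        rw [Real.dist_eq, abs_lt] at hd
        have h3s : 0 < 3 * s := by positivity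
        have f1 := (le_div_iff₀ h3s).1 (Int.floor_le (k (c w) / (3 * s)))
        have f2 := (div_lt_iff₀ h3s).1 (Int.lt_floor_add_one (k (c w) / (3 * s)))
        have hc0 : (0 : ℝ) ≤ (col w : ℕ) := Nat.cast_nonneg _
        have hc2 : (((col w : ℕ)) : ℝ) ≤ 2 := by exact_mod_cast Nat.le_of_lt_succ (col w).2
        have e : s * (h w : ℝ) = ⌊k (c w) / (3 * s)⌋ * (3 * s) + s * (col w : ℕ) := by
          simp only [h]
          push_cast
          ring
        change s * (h w : ℝ) ∈ Icc _ _
        rw [e]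
        constructor <;> nlinarith
    exact abs_le.2 ⟨by linarith [hmem.1], by linarith [hmem.2]⟩

end Ribbons

/-! ### Reduction from disks to complexes -/

/-- If an ANR `X` has the fuzzy ribbons property, then `X × ℝ` has the disjoint disks property. -/
theorem mainTheorem8 {X : Type*} [MetricSpace X] (hX : Ribbons.IsANR X)
    (hfrp : Ribbons.FuzzyRibbonsProperty X) : Ribbons.DDP (X × ℝ) := by
  intro f g ε hε
  let fX : C(Ribbons.Disk 2, X) := ContinuousMap.fst.comp f
  let gX : C(Ribbons.Disk 2, X) := ContinuousMap.fst.comp g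
  -- `δ` is fixed before the complexes, whose fineness depends on it. This is possible because it
  -- depends only on a compact set containing both images.
  obtain ⟨δ, hδ, hext⟩ := hX.exists_extension_of_close
    ((isCompact_range fX.continuous).union (isCompact_range gX.continuous))
    (show 0 < ε / 8 by positivity)
  have hη : 0 < min (ε / 8) (δ / 2) := by positivity
  obtain ⟨ρ₁, hρ₁, hf⟩ := Metric.uniformContinuous_iff.1
    (CompactSpace.uniformContinuous_of_continuous fX.continuous) _ hη
  obtain ⟨ρ₂, hρ₂, hg⟩ := Metric.uniformContinuous_iff.1
    (CompactSpace.uniformContinuous_of_continuous gX.continuous) _ hη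
  -- One unit of height is `ε / 10`: the model costs `4` units and the ribbons `1`, in total `ε /
  -- 2`.
  have hs : 0 < ε / 10 := by positivity
  obtain ⟨W₁, _, Γ₁, h₁, α₁, β₁, hΓ₁, hh₁, hαβ₁, hβ₁, hk₁⟩ :=
    Ribbons.exists_complex_model (ContinuousMap.snd.comp f) hρ₁ hs
  obtain ⟨W₂, _, Γ₂, h₂, α₂, β₂, hΓ₂, hh₂, hαβ₂, hβ₂, hk₂⟩ :=
    Ribbons.exists_complex_model (ContinuousMap.snd.comp g) hρ₂ hs
  obtain ⟨f', g', hf', hg', hne⟩ := Ribbons.exists_disjoint_complex_maps hX hfrp hΓ₁ hΓ₂ hh₁ hh₂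
    (fX.comp β₁) (gX.comp β₂) (show 0 < ε / 8 by positivity) hδ
    (hext _ _ fun z => Or.inl (Set.mem_range_self _))
    (hext _ _ fun z => Or.inr (Set.mem_range_self _))
    (fun x y hxy => hf (hβ₁ x y hxy)) (fun x y hxy => hg (hβ₂ x y hxy))
  have close : ∀ (p q : X × ℝ) (r : X) (H : ℝ), dist p.1 r < 3 * (ε / 8) → |p.2 - H| ≤ 1 →
      dist r q.1 < ε / 8 → |ε / 10 * H - q.2| ≤ 4 * (ε / 10) →
      dist (p.1, ε / 10 * p.2) q < ε := by
    intro p q r H h1 h2 h3 h4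
    rw [Prod.dist_eq]
    refine max_lt ?_ ?_
    · linarith [dist_triangle p.1 r q.1]
    · rw [Real.dist_eq]
      rw [abs_le] at h2 h4
      exact abs_lt.2 ⟨by nlinarith, by nlinarith⟩
  refine ⟨⟨fun z => ((f' (α₁ z)).1, ε / 10 * (f' (α₁ z)).2), by fun_prop⟩,
    ⟨fun z => ((g' (α₂ z)).1, ε / 10 * (g' (α₂ z)).2), by fun_prop⟩, fun z => ?_, fun z => ?_, ?_⟩
  · exact close _ _ _ _ (hf' (α₁ z)).1 (hf' (α₁ z)).2
      ((hf (hαβ₁ z)).trans_le (min_le_left _ _)) (hk₁ z)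
  · exact close _ _ _ _ (hg' (α₂ z)).1 (hg' (α₂ z)).2
      ((hg (hαβ₂ z)).trans_le (min_le_left _ _)) (hk₂ z)
  · rw [Set.disjoint_left]
    rintro _ ⟨z, rfl⟩ ⟨w, hw⟩
    obtain ⟨e1, e2⟩ := Prod.ext_iff.1 hw
    exact hne (α₁ z) (α₂ w) (Prod.ext e1.symm (mul_left_cancel₀ hs.ne' e2.symm))
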